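/- \textbf{Conventions.} A \emph{right LCM monoid} is a left cancellative monoid $S$ in which the intersection of any two principal right ideals $sS$, $tS$ is empty or again a principal right ideal. Write $s\Cap t$ if $sS\cap tS\neq\emptyset$ and $s\perp t$ otherwise. The \emph{core} is the submonoid $S_c=\{a\in S: a\Cap s\text{ for all }s\in S\}$, and $s\sim t$ (\emph{core equivalence}) means $sa=tb$ for some $a,b\in S_c$. Left multiplication gives an action $\alpha$ of $S_c$ on $S/_\sim$, $\alpha_a([s])=[as]$. An element $s\in S\setminus S_c$ is \emph{noncore irreducible} if $sa=tr$ with $a\in S_c$, $t,r\in S$ implies $t\in S_c$ or $r\in S_c$; let $\mathcal I(S)$ be the set of these elements. The \emph{core graph} $\Gamma(S)$ is the simple graph with vertex set $\mathcal I(S)/_\sim$ in which $[s]\neq[t]$ are adjacent iff $s\Cap t$. The \emph{coconnected components} of a graph are the full subgraphs on the vertex sets of the connected components of the complementary graph; for $s\in\mathcal I(S)$ let $i(s)$ denote the coconnected component of $\Gamma(S)$ containing $[s]$. $S$ is \emph{noncore factorable} if every element of $S\setminus S_c$ is core equivalent to a finite product of elements of $\mathcal I(S)$. $S$ has \emph{balanced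 factorization} if for all $s,t\in\mathcal I(S)$ with $i(s)\ne i(t)$ there are $s',t'\in\mathcal I(S)$ with $sS\cap tS=st'S$, $st'=ts'$, $i(s')=i(s)$ and $i(t')=i(t)$. A \emph{generalized scale} on $S$ is a nontrivial homomorphism $N\colon S\to\mathbb N^\times$, $s\mapsto N_s$, such that $|N^{-1}(n)/_\sim|=n$ for all $n\in N(S)$; $N_s=N_t$ implies $s\sim t$ or $s\perp t$; and for all $s\in S$, $n\in N(S)$ there is $t\in N^{-1}(n)$ with $s\Cap t$. A family $(c_i)_{i\in I}$ in $\mathbb N^\times\cup\{\infty\}$ \emph{freely generates a nontrivial submonoid of $\mathbb N^\times$} if all $c_i$ are finite, the induced homomorphism from the free commutative monoid on $I$ to $\mathbb N^\times$ is injective, and its image is not $\{1\}$. \textbf{Theorem.} Let $\Lambda=(W,F)$ be a simple undirected graph (possibly infinite), let $(S_w)_{w\in W}$ be a family of right LCM monoids, and let the graph product $S(\Lambda)$ be the quotient of the free product $\ast_{w\in W}S_w$ by the congruence generated by $st=ts$ for $s\in S_v$, $t\in S_w$, $(v,w)\in F$. Let $(\Lambda_j)_{j\in J}$ be the coconnected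 components of $\Lambda$, and let $S(\Lambda_j)$ be the graph product of the monoids $S_w$ over the vertices $w$ of $\Lambda_j$. Then $S(\Lambda)$ and all $S(\Lambda_j)$ are right LCM monoids, there is a canonical isomorphism $S(\Lambda)=\bigoplus_{j\in J}S(\Lambda_j)$ (the copy of $S_w$ in $S(\Lambda)$, $w$ a vertex of $\Lambda_j$, is identified with its copy in the $j$-th summand), and the following hold. \begin{enumerate} \item[(i)] Under this identification, $\mathcal I(S(\Lambda))=\bigsqcup_{j\in J}\Big(\mathcal I(S(\Lambda_j))\oplus\bigoplus_{j'\in J\setminus\{j\}}S(\Lambda_{j'})_c\Big)$, a disjoint union. \item[(ii)] The coconnected components of $\Gamma(S(\Lambda))$ are edge-free if and only if the coconnected components of $\Gamma(S(\Lambda_j))$ are edge-free for all $j\in J$. \item[(iii)] $S(\Lambda)$ is noncore factorable if and only if $S(\Lambda_j)$ is noncore factorable for all $j\in J$. \item[(iv)] $S(\Lambda)$ has balanced factorization if and only if, for all $j\in J$, $S(\Lambda_j)$ has balanced factorization and $\alpha\colon S(\Lambda_j)_c\curvearrowright S(\Lambda_j)/_\sim$ restricts to an action by bijections on the vertex set of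 each coconnected component of $\Gamma(S(\Lambda_j))$. \end{enumerate} In particular, $S(\Lambda)$ has a generalized scale if and only if, for every $j\in J$, the coconnected components of $\Gamma(S(\Lambda_j))$ are edge-free, $S(\Lambda_j)$ is noncore factorable and $S(\Lambda_j)$ has balanced factorization, and moreover the family $(|V_i|)_{i\in\bigsqcup_{j\in J}I_j}$ freely generates a nontrivial submonoid of $\mathbb N^\times$, where $(V_i)_{i\in I_j}$ are the vertex sets of the coconnected components of $\Gamma(S(\Lambda_j))$ and $|V_i|\in\mathbb N^\times\cup\{\infty\}$. -/

import Mathlib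

namespace GenScale

/-! ### Right LCM monoids, the core, core equivalence -/

section Monoids

variable {S : Type*} [Monoid S]

/-- The principal right ideal `sS`. -/
def rightIdeal (s : S) : Set S := Set.range (fun r : S => s * r)

/-- `s ⋒ t`: the principal right ideals `sS` and `tS` intersect.  Its negation is `s ⊥ t`. -/
def Meets (s t : S) : Prop := (rightIdeal s ∩ rightIdeal t).Nonempty

/-- A right LCM monoid: a left cancellative monoid in which the intersection of two principal
right ideals is empty or a principal right ideal. -/
class IsRightLCM (S : Type*) [Monoid S] : Prop extends IsLeftCancelMul S where
  inter_principal : ∀ s t : S, rightIdeal s ∩ rightIdeal t = ∅ ∨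
    ∃ r : S, rightIdeal s ∩ rightIdeal t = rightIdeal r

theorem meets_iff {s t : S} : Meets s t ↔ ∃ x y : S, s * x = t * y := by
  constructor
  · rintro ⟨_, ⟨x, rfl⟩, ⟨y, hy⟩⟩
    exact ⟨x, y, hy.symm⟩
  · rintro ⟨x, y, h⟩
    exact ⟨s * x, ⟨x, rfl⟩, ⟨y, h.symm⟩⟩

theorem Meets.symm {s t : S} (h : Meets s t) : Meets t s := by
  unfold Meets at *
  rwa [Set.inter_comm]

variable (S) in
/-- The core `S_c` of `S`: the elements `a` with `a ⋒ s` for all `s`. -/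
def core : Submonoid S where
  carrier := {a | ∀ s : S, Meets a s}
  one_mem' := fun s => meets_iff.2 ⟨s, 1, by simp⟩
  mul_mem' := by
    intro a b ha hb s
    obtain ⟨x, y, h⟩ := meets_iff.1 (ha s)
    obtain ⟨u, v, h'⟩ := meets_iff.1 (hb x)
    exact meets_iff.2 ⟨u, y * v, by rw [mul_assoc, h', ← mul_assoc, h, mul_assoc]⟩

/-- Core equivalence `s ∼ t`: there are `a, b ∈ S_c` with `sa = tb`. -/
def CoreEquiv (s t : S) : Prop := ∃ a ∈ core S, ∃ b ∈ core S, s * a = t * b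

theorem mem_core_of_inter [IsRightLCM S] {a s b : S} (ha : a ∈ core S)
    (h : rightIdeal a ∩ rightIdeal s = rightIdeal (s * b)) : b ∈ core S := by
  intro t
  obtain ⟨x, y, hxy⟩ := meets_iff.1 (ha (s * t))
  have hmem : a * x ∈ rightIdeal a ∩ rightIdeal s :=
    ⟨⟨x, rfl⟩, ⟨t * y, by simp only; rw [hxy, mul_assoc]⟩⟩
  rw [h] at hmem
  obtain ⟨z, hz⟩ := hmem
  refine meets_iff.2 ⟨z, y, ?_⟩
  have : s * (b * z) = s * (t * y) := by
    rw [← mul_assoc, ← mul_assoc, ← hxy]; exact hz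
  exact mul_left_cancel this

theorem coreEquiv_trans [IsRightLCM S] {s t r : S} (h₁ : CoreEquiv s t) (h₂ : CoreEquiv t r) :
    CoreEquiv s r := by
  obtain ⟨a, ha, b, hb, hab⟩ := h₁
  obtain ⟨c, hc, d, hd, hcd⟩ := h₂
  obtain h | ⟨m, hm⟩ := IsRightLCM.inter_principal b c
  · exact absurd (hb c) (by unfold Meets; rw [h]; exact Set.not_nonempty_empty)
  have hmm : m ∈ rightIdeal b ∩ rightIdeal c := by rw [hm]; exact ⟨1, by simp⟩
  obtain ⟨⟨x, hx⟩, ⟨y, hy⟩⟩ := hmm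
  simp only at hx hy
  have hy' : y ∈ core S := mem_core_of_inter hb (by rw [hm, hy])
  have hx' : x ∈ core S := mem_core_of_inter hc (by rw [Set.inter_comm, hm, hx])
  refine ⟨a * x, mul_mem ha hx', d * y, mul_mem hd hy', ?_⟩
  rw [← mul_assoc, hab, mul_assoc, hx, ← hy, ← mul_assoc, hcd, mul_assoc]

variable (S) in
/-- Core equivalence as an equivalence relation. -/
def coreSetoid [IsRightLCM S] : Setoid S where
  r := CoreEquiv
  iseqv :=
    { refl := fun _ => ⟨1, one_mem _, 1, one_mem _, rfl⟩
      symm := fun ⟨a, ha, b, hb, h⟩ => ⟨b, hb, a, ha, h.symm⟩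
      trans := coreEquiv_trans }

variable (S) in
/-- The quotient `S/∼`. -/
abbrev CoreQuotient [IsRightLCM S] : Type _ := Quotient (coreSetoid S)

/-- The class `[s] ∈ S/∼`. -/
def coreClass [IsRightLCM S] (s : S) : CoreQuotient S := Quotient.mk (coreSetoid S) s

/-- The action `α : S_c ↷ S/∼`, `α_a([s]) = [as]`. -/
instance coreMulAction [IsRightLCM S] : MulAction (core S) (CoreQuotient S) where
  smul a := Quotient.map (fun s => (a : S) * s) (by
    rintro s t ⟨b, hb, c, hc, h⟩
    exact ⟨b, hb, c, hc, by rw [mul_assoc, h, mul_assoc]⟩)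
  one_smul := by
    rintro ⟨s⟩
    exact congrArg coreClass (one_mul s)
  mul_smul := by
    rintro a b ⟨s⟩
    exact congrArg coreClass (mul_assoc (a : S) b s)

/-! ### Noncore irreducibles and the core graph -/

variable (S) in
/-- The set `𝓘(S)` of noncore irreducible elements. -/
def noncoreIrred : Set S :=
  {s | s ∉ core S ∧ ∀ a ∈ core S, ∀ t r : S, s * a = t * r → t ∈ core S ∨ r ∈ core S}

variable (S) in
/-- The vertex set `𝓘(S)/∼ ⊆ S/∼` of the core graph. -/
def coreVertices [IsRightLCM S] : Set (CoreQuotient S) := coreClass '' noncoreIrred S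

variable (S) in
/-- The core graph `Γ(S)`: distinct classes `[s] ≠ [t]` in `𝓘(S)/∼` are adjacent iff `s ⋒ t`. -/
def coreGraph [IsRightLCM S] : SimpleGraph (coreVertices S) where
  Adj x y := x ≠ y ∧ ∃ s ∈ noncoreIrred S, ∃ t ∈ noncoreIrred S,
    coreClass s = (x : CoreQuotient S) ∧ coreClass t = (y : CoreQuotient S) ∧ Meets s t
  symm := ⟨fun _ _ ⟨hne, s, hs, t, ht, hx, hy, h⟩ => ⟨hne.symm, t, ht, s, hs, hy, hx, h.symm⟩⟩
  loopless := ⟨fun _ h => h.1 rfl⟩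

/-- The index set of the coconnected components of a graph `G`, i.e. of the connected components
of the complementary graph. -/
abbrev CoComponent {V : Type*} (G : SimpleGraph V) : Type _ := Gᶜ.ConnectedComponent

/-- The index `i(s)` of the coconnected component of `Γ(S)` that contains `[s]`. -/
def coIndex [IsRightLCM S] (s : noncoreIrred S) : CoComponent (coreGraph S) :=
  (coreGraph S)ᶜ.connectedComponentMk ⟨coreClass (s : S), Set.mem_image_of_mem _ s.2⟩

/-- The vertex set `V_i ⊆ S/∼` of a coconnected component `Γ_i` of `Γ(S)`. -/
def componentVertices [IsRightLCM S] (i : CoComponent (coreGraph S)) : Set (CoreQuotient S) :=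
  Subtype.val '' i.supp

/-- The size `|V_i| ∈ ℕ ∪ {∞}` of a coconnected component of `Γ(S)`. -/
noncomputable def componentSize [IsRightLCM S] (i : CoComponent (coreGraph S)) : ℕ∞ :=
  (componentVertices i).encard

variable (S)

/-- The coconnected components of `Γ(S)` are edge-free. -/
def ComponentsEdgeFree [IsRightLCM S] : Prop :=
  ∀ i : CoComponent (coreGraph S), (coreGraph S).induce i.supp = ⊥

/-- `S` is noncore factorable: every element of `S ∖ S_c` is core equivalent to a finite product
of noncore irreducibles. -/
def NoncoreFactorable : Prop :=
  ∀ s : S, s ∉ core S → ∃ l : List S, (∀ x ∈ l, x ∈ noncoreIrred S) ∧ CoreEquiv s l.prod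

/-- `S` has balanced factorization. -/
def BalancedFactorization [IsRightLCM S] : Prop :=
  ∀ s t : noncoreIrred S, coIndex s ≠ coIndex t →
    ∃ s' t' : noncoreIrred S,
      rightIdeal (s : S) ∩ rightIdeal (t : S) = rightIdeal ((s : S) * t') ∧
      (s : S) * t' = (t : S) * s' ∧ coIndex s' = coIndex s ∧ coIndex t' = coIndex t

/-- The action `α : S_c ↷ S/∼` restricts to an action (by bijections) on the vertex set of each
coconnected component of `Γ(S)`. -/
def ActionPreservesComponents [IsRightLCM S] : Prop :=
  ∀ (a : core S) (i : CoComponent (coreGraph S)),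
    Set.BijOn (fun x : CoreQuotient S => a • x) (componentVertices i) (componentVertices i)

variable {S}

/-- A generalized scale: a nontrivial homomorphism `N : S → ℕ^×` such that
`|N⁻¹(n)/∼| = n` for `n ∈ N(S)`, `N_s = N_t` implies `s ∼ t` or `s ⊥ t`, and for all `s ∈ S` and
`n ∈ N(S)` there is `t ∈ N⁻¹(n)` with `s ⋒ t`. -/
structure IsGeneralizedScale [IsRightLCM S] (N : S →* ℕ+) : Prop where
  nontrivial : N ≠ 1
  card_fiber : ∀ n ∈ Set.range N,
    (coreClass '' {s : S | N s = n} : Set (CoreQuotient S)).encard = ((n : ℕ) : ℕ∞)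
  equiv_or_orthogonal : ∀ s t : S, N s = N t → CoreEquiv s t ∨ ¬ Meets s t
  exists_meets : ∀ (s : S), ∀ n ∈ Set.range N, ∃ t : S, N t = n ∧ Meets s t

end Monoids

/-- A family in `ℕ ∪ {∞}` freely generates a nontrivial submonoid of `ℕ^×`: all its members lie in
`ℕ^×`, the induced homomorphism from the free commutative monoid on the index set to `ℕ^×` is
injective, and the submonoid generated is not `{1}`. -/
def FreelyGeneratesNontrivial {I : Type*} (c : I → ℕ∞) : Prop :=
  ∃ m : I → ℕ+, (∀ i, c i = ((m i : ℕ) : ℕ∞)) ∧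
    Function.Injective (fun f : I →₀ ℕ => f.prod fun i k => m i ^ k) ∧
    Submonoid.closure (Set.range m) ≠ ⊥

/-! ### Graph products -/

section GraphProducts

variable {W : Type*} (Λ : SimpleGraph W) (S : W → Type*) [∀ w, Monoid (S w)]

/-- The congruence on the free product `∗_w S_w` generated by `st = ts` for `s ∈ S_v`, `t ∈ S_w`
with `v`, `w` adjacent. -/
def graphCon : Con (Monoid.CoprodI S) :=
  conGen fun x y => ∃ v w : W, Λ.Adj v w ∧ ∃ (s : S v) (t : S w),
    x = Monoid.CoprodI.of s * Monoid.CoprodI.of t ∧ y = Monoid.CoprodI.of t * Monoid.CoprodI.of s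

/-- The graph product `S(Λ)`. -/
abbrev GraphProduct : Type _ := (graphCon Λ S).Quotient

/-- The canonical homomorphism `S_w → S(Λ)`. -/
def GraphProduct.of (w : W) : S w →* GraphProduct Λ S :=
  (graphCon Λ S).mk'.comp Monoid.CoprodI.of

/-- The graph product `S(Λ_j)` over a coconnected component `Λ_j` of `Λ`. -/
abbrev ComponentProduct (j : CoComponent Λ) : Type _ :=
  GraphProduct (Λ.induce j.supp) (fun w => S w)

/-- The direct sum `⨁_j M_j` of monoids: the finitely supported elements of the product. -/
def directSum {J : Type*} (M : J → Type*) [∀ j, Monoid (M j)] : Submonoid (∀ j, M j) where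
  carrier := {f | {j | f j ≠ 1}.Finite}
  one_mem' := by simp
  mul_mem' := by
    intro f g hf hg
    refine (Set.Finite.union hf hg).subset fun j hj => ?_
    by_contra h
    simp only [Set.mem_union, Set.mem_ofPred_eq, not_or, not_not] at h
    exact hj (by rw [Pi.mul_apply, h.1, h.2, one_mul])

/-- `e` is the canonical isomorphism `S(Λ) = ⨁_j S(Λ_j)`: it sends the copy of `s ∈ S_w`, where
`w` is a vertex of `Λ_j`, to the copy of `s` in the `j`-th summand. -/
def IsCanonicalDecomposition (e : GraphProduct Λ S ≃* directSum (ComponentProduct Λ S)) : Prop :=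
  ∀ (j : CoComponent Λ) (w : j.supp) (s : S w),
    (e (GraphProduct.of Λ S w s) : ∀ j, ComponentProduct Λ S j) j =
      GraphProduct.of (Λ.induce j.supp) (fun w => S w) w s ∧
    ∀ j', j' ≠ j → (e (GraphProduct.of Λ S w s) : ∀ j, ComponentProduct Λ S j) j' = 1

/-- The subset `𝓘(S(Λ_j)) ⊕ ⨁_{j' ≠ j} S(Λ_{j'})_c` of `⨁_j S(Λ_j)`. -/
def irredSummand (j : CoComponent Λ) : Set (directSum (ComponentProduct Λ S)) :=
  {x | (x : ∀ j, ComponentProduct Λ S j) j ∈ noncoreIrred (ComponentProduct Λ S j) ∧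
    ∀ j', j' ≠ j → (x : ∀ j, ComponentProduct Λ S j) j' ∈ core (ComponentProduct Λ S j')}

end GraphProducts

end GenScale

open GenScale

/-!
The proof combines three independent facts.

**Graph products of right LCM monoids are right LCM.** The graph product acts on reduced words up to
shuffling (`RedTrace`), which gives every element a normal form.  The normal form splits each `p`
as `head w p * tail w p` with `head w p ∈ S w`, where the head transforms under `S w` by left
multiplication, ignores the vertex monoids at vertices adjacent to `w`, and is trivial whenever a
head at another, nonadjacent vertex is not.  Left cancellation is immediate from this.  For least
common multiples it suffices to treat `s ∈ S w` and an arbitrary `q`.  By `head_mul_dichotomy`,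
either the `w`-head of `q * x` is independent of `x`, so that `q` is a multiple of `s` as soon as
the two meet; or, up to a unit on the right, `q = h * a` with `h ∈ S w` and `a` invisible at `w`,
and the question is reduced to `s` and `h` in `S w`.

**The characterization of generalized scales** (`exists_isGeneralizedScale_iff`).  If `N` is a
generalized scale, then factorizations in the image of `N` lift to `S`, so the noncore irreducibles
are the elements with irreducible scale.  Two of them with distinct scales always meet, by a count
of the finitely many classes of given scale (`meets_of_irred`), and their least common multiple has
the product as scale.  Hence the coconnected components are the fibres of `N` over the irreducible
elements of `N(S)`, and these are prime in `N(S)`.  Conversely, edge-freeness and balanced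
factorization allow a noncore irreducible to be moved through products of noncore irreducibles
(`DegWord.split_or_isLcm`).  So every element has a well-defined degree, the multiset of components
of its factors, and `N` sends an element to the product of the sizes of these components.

**Direct sums.** Vertices in distinct coconnected components of `Λ` are adjacent, so the graph
product is a direct sum.  In a direct sum, meeting, least common multiples, the core and core
equivalence are determined coordinatewise (`IsDirectSum`), a noncore irreducible has exactly one
noncore coordinate, and the coconnected components of the core graph are those of the summands
(`IsDirectSum.comp`).  Balanced factorization in the sum involves a core element in one
coordinate and a noncore irreducible in the same coordinate, which is where the action `α` enters.
That `α` preserves the components is in fact a consequence of balanced factorization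
(`BalancedFactorization.actionPreservesComponents`).
-/

namespace GenScale

/-! ### Least common multiples, the core and core equivalence -/

section Basics

variable {S : Type*} [Monoid S]

/-- `s * x = t * y` is a right least common multiple of `s` and `t`, i.e. every common right
multiple of `s` and `t` factors through it. -/
def IsLcm (s t x y : S) : Prop :=
  s * x = t * y ∧ ∀ u v : S, s * u = t * v → ∃ w, u = x * w ∧ v = y * w

theorem IsLcm.symm {s t x y : S} (h : IsLcm s t x y) : IsLcm t s y x :=
  ⟨h.1.symm, fun u v huv => let ⟨w, h₁, h₂⟩ := h.2 v u huv.symm; ⟨w, h₂, h₁⟩⟩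

theorem isLcm_iff [IsLeftCancelMul S] {s t x y : S} :
    IsLcm s t x y ↔ rightIdeal s ∩ rightIdeal t = rightIdeal (s * x) ∧ s * x = t * y := by
  constructor
  · rintro ⟨h, hu⟩
    refine ⟨Set.Subset.antisymm ?_ ?_, h⟩
    · rintro _ ⟨⟨u, rfl⟩, ⟨v, hv⟩⟩
      obtain ⟨w, rfl, -⟩ := hu u v hv.symm
      exact ⟨w, mul_assoc _ _ _⟩
    · rintro _ ⟨w, rfl⟩
      exact ⟨⟨x * w, by simp [mul_assoc]⟩, ⟨y * w, by simp only; rw [h, mul_assoc]⟩⟩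
  · rintro ⟨h, hxy⟩
    refine ⟨hxy, fun u v huv => ?_⟩
    have : s * u ∈ rightIdeal s ∩ rightIdeal t := ⟨⟨u, rfl⟩, ⟨v, huv.symm⟩⟩
    rw [h] at this
    obtain ⟨w, hw⟩ := this
    simp only at hw
    refine ⟨w, ?_, ?_⟩
    · rw [mul_assoc] at hw
      exact (mul_left_cancel hw).symm
    · rw [hxy, huv, mul_assoc] at hw
      exact (mul_left_cancel hw).symm

theorem Meets.of_eq {s t x y : S} (h : s * x = t * y) : Meets s t := meets_iff.2 ⟨x, y, h⟩

theorem meets_one_left (s : S) : Meets 1 s := Meets.of_eq (x := s) (y := 1) (by simp)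

theorem mul_left_mem_core {a b : S} (h : a * b ∈ core S) : a ∈ core S := by
  intro s
  obtain ⟨x, y, hxy⟩ := meets_iff.1 (h s)
  exact Meets.of_eq (x := b * x) (y := y) (by rw [← mul_assoc, hxy])

section Cancel

variable [IsLeftCancelMul S]

theorem meets_mul_left_iff {a s t : S} : Meets (a * s) (a * t) ↔ Meets s t := by
  simp only [meets_iff, mul_assoc, mul_right_inj]

theorem coreEquiv_mul_left_iff {a s t : S} : CoreEquiv (a * s) (a * t) ↔ CoreEquiv s t := by
  simp only [CoreEquiv, mul_assoc, mul_right_inj]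

theorem mul_right_mem_core {a b : S} (h : a * b ∈ core S) : b ∈ core S :=
  fun s => meets_mul_left_iff.1 (h (a * s))

theorem mul_mem_core_iff {a b : S} : a * b ∈ core S ↔ a ∈ core S ∧ b ∈ core S :=
  ⟨fun h => ⟨mul_left_mem_core h, mul_right_mem_core h⟩, fun h => mul_mem h.1 h.2⟩

end Cancel

theorem CoreEquiv.refl (s : S) : CoreEquiv s s := ⟨1, one_mem _, 1, one_mem _, rfl⟩

theorem CoreEquiv.symm {s t : S} : CoreEquiv s t → CoreEquiv t s :=
  fun ⟨a, ha, b, hb, h⟩ => ⟨b, hb, a, ha, h.symm⟩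

theorem coreEquiv_mul_core (s : S) {a : S} (ha : a ∈ core S) : CoreEquiv (s * a) s :=
  ⟨1, one_mem _, a, ha, mul_one _⟩

theorem CoreEquiv.meets {s t : S} : CoreEquiv s t → Meets s t :=
  fun ⟨_, _, _, _, h⟩ => Meets.of_eq h

theorem CoreEquiv.mem_core {s t : S} (h : CoreEquiv s t) (hs : s ∈ core S) : t ∈ core S := by
  obtain ⟨a, ha, b, hb, hab⟩ := h
  exact mul_left_mem_core (hab ▸ mul_mem hs ha)

theorem Meets.of_coreEquiv_left {s s' t : S} (h : Meets s t) (hs : CoreEquiv s s') :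
    Meets s' t := by
  obtain ⟨a, ha, b, hb, hab⟩ := hs
  obtain ⟨x, y, hxy⟩ := meets_iff.1 h
  obtain ⟨u, v, huv⟩ := meets_iff.1 (ha x)
  exact Meets.of_eq (x := b * u) (y := y * v)
    (by rw [← mul_assoc, ← hab, mul_assoc, huv, ← mul_assoc, hxy, mul_assoc])

theorem Meets.of_coreEquiv {s s' t t' : S} (h : Meets s t) (hs : CoreEquiv s s')
    (ht : CoreEquiv t t') : Meets s' t' :=
  ((h.of_coreEquiv_left hs).symm.of_coreEquiv_left ht).symm

/-- A least common multiple with a product is obtained in two steps. -/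
theorem IsLcm.comp {s t t' x y x' y' : S} (h : IsLcm s t x y) (h' : IsLcm y t' x' y') :
    IsLcm s (t * t') (x * x') y' := by
  refine ⟨by rw [← mul_assoc, h.1, mul_assoc, h'.1, mul_assoc], fun u v huv => ?_⟩
  obtain ⟨w, rfl, hw⟩ := h.2 u (t' * v) (by rw [huv, mul_assoc])
  obtain ⟨z, rfl, rfl⟩ := h'.2 w v hw.symm
  exact ⟨z, (mul_assoc _ _ _).symm, rfl⟩

variable [IsRightLCM S]

theorem Meets.exists_isLcm {s t : S} (h : Meets s t) : ∃ x y, IsLcm s t x y := by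
  obtain h' | ⟨r, hr⟩ := IsRightLCM.inter_principal s t
  · exact absurd h (by unfold Meets; rw [h']; exact Set.not_nonempty_empty)
  · have : r ∈ rightIdeal s ∩ rightIdeal t := by rw [hr]; exact ⟨1, mul_one r⟩
    obtain ⟨⟨x, rfl⟩, ⟨y, hy⟩⟩ := this
    exact ⟨x, y, isLcm_iff.2 ⟨hr, hy.symm⟩⟩

theorem IsLcm.mem_core {a s x y : S} (h : IsLcm a s x y) (ha : a ∈ core S) : y ∈ core S := by
  have h' := isLcm_iff.1 h
  exact mem_core_of_inter ha (h'.2 ▸ h'.1)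

/-- A core element can be pushed through any element, up to the core. -/
theorem exists_core_isLcm {a : S} (ha : a ∈ core S) (s : S) :
    ∃ x, ∃ b ∈ core S, IsLcm a s x b :=
  let ⟨x, y, h⟩ := (ha s).exists_isLcm
  ⟨x, y, h.mem_core ha, h⟩

theorem coreEquiv_of_mem_core {a b : S} (ha : a ∈ core S) (hb : b ∈ core S) : CoreEquiv a b :=
  let ⟨c, d, hd, h⟩ := exists_core_isLcm ha b
  ⟨c, h.symm.mem_core hb, d, hd, h.1⟩

theorem CoreEquiv.trans {s t r : S} (h₁ : CoreEquiv s t) (h₂ : CoreEquiv t r) : CoreEquiv s r :=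
  coreEquiv_trans h₁ h₂

/-! ### Noncore irreducibles and coconnected components of the core graph -/

theorem CoreEquiv.mem_noncoreIrred {s t : S} (h : CoreEquiv s t) (hs : s ∈ noncoreIrred S) :
    t ∈ noncoreIrred S := by
  refine ⟨fun ht => hs.1 (h.symm.mem_core ht), fun c hc x y hxy => ?_⟩
  obtain ⟨a, ha, b, hb, hab⟩ := h
  obtain ⟨u, hu, v, hv, huv⟩ := coreEquiv_of_mem_core hb hc
  refine (hs.2 (a * u) (mul_mem ha hu) x (y * v) ?_).imp_right mul_left_mem_core
  rw [← mul_assoc, hab, mul_assoc, huv, ← mul_assoc, hxy, mul_assoc]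

theorem core_mul_mem_noncoreIrred_iff {a s : S} (ha : a ∈ core S) :
    a * s ∈ noncoreIrred S ↔ s ∈ noncoreIrred S := by
  constructor
  · rintro ⟨h₁, h₂⟩
    refine ⟨fun h => h₁ (mul_mem ha h), fun b hb t r htr => ?_⟩
    exact (h₂ b hb (a * t) r (by rw [mul_assoc, htr, mul_assoc])).imp_left mul_right_mem_core
  · intro hs
    refine ⟨fun h => hs.1 (mul_right_mem_core h), fun b hb t r htr => ?_⟩
    obtain ⟨u, c, hc, h⟩ := exists_core_isLcm ha t
    obtain ⟨w, h₁, rfl⟩ := h.2 (s * b) r (by rw [← mul_assoc, htr])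
    refine (hs.2 b hb u w h₁).imp (fun hu => ?_) (mul_mem hc)
    exact mul_left_mem_core (h.1 ▸ mul_mem ha hu)

theorem coreClass_eq_iff {s t : S} : coreClass s = coreClass t ↔ CoreEquiv s t :=
  Quotient.eq (r := coreSetoid S)

theorem coreClass_surjective : Function.Surjective (coreClass : S → CoreQuotient S) :=
  Quotient.mk_surjective

/-- `s` is a noncore irreducible whose class lies in the coconnected component `i` of `Γ(S)`. -/
def InComp (i : CoComponent (coreGraph S)) (s : S) : Prop :=
  ∃ h : s ∈ noncoreIrred S, coIndex ⟨s, h⟩ = i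

theorem inComp_coIndex (s : noncoreIrred S) : InComp (coIndex s) (s : S) := ⟨s.2, rfl⟩

theorem exists_inComp {s : S} (hs : s ∈ noncoreIrred S) : ∃ i, InComp i s := ⟨_, hs, rfl⟩

theorem coIndex_eq_of_class_eq {s t : noncoreIrred S} (h : CoreEquiv (s : S) t) :
    coIndex s = coIndex t := by
  unfold coIndex
  congr 2
  exact coreClass_eq_iff.2 h

theorem coIndex_surjective (i : CoComponent (coreGraph S)) : ∃ s, InComp i s := by
  induction i using SimpleGraph.ConnectedComponent.ind with
  | h v =>
    obtain ⟨_, s, hs, rfl⟩ := v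
    exact ⟨s, hs, rfl⟩

variable {i j : CoComponent (coreGraph S)} {s t : S}

theorem InComp.irred (h : InComp i s) : s ∈ noncoreIrred S := h.1

theorem InComp.unique (h : InComp i s) (h' : InComp j s) : i = j := by
  obtain ⟨_, rfl⟩ := h
  obtain ⟨_, rfl⟩ := h'
  rfl

theorem InComp.of_coreEquiv (h : InComp i s) (hst : CoreEquiv s t) : InComp i t := by
  obtain ⟨hs, rfl⟩ := h
  exact ⟨hst.mem_noncoreIrred hs, coIndex_eq_of_class_eq hst.symm⟩

theorem coreGraph_adj_iff (hs : s ∈ noncoreIrred S) (ht : t ∈ noncoreIrred S) :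
    (coreGraph S).Adj ⟨coreClass s, Set.mem_image_of_mem _ hs⟩
      ⟨coreClass t, Set.mem_image_of_mem _ ht⟩ ↔ ¬ CoreEquiv s t ∧ Meets s t := by
  constructor
  · rintro ⟨hne, s', -, t', -, h₁, h₂, h⟩
    refine ⟨fun h => hne (Subtype.ext (coreClass_eq_iff.2 h)), ?_⟩
    exact h.of_coreEquiv (coreClass_eq_iff.1 h₁) (coreClass_eq_iff.1 h₂)
  · rintro ⟨h₁, h₂⟩
    exact ⟨fun h => h₁ (coreClass_eq_iff.1 (congrArg Subtype.val h)), s, hs, t, ht, rfl, rfl, h₂⟩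

theorem InComp.of_not_meets (hi : InComp i s) (ht : t ∈ noncoreIrred S) (h : ¬ Meets s t) :
    InComp i t := by
  obtain ⟨hs, rfl⟩ := hi
  refine ⟨ht, (SimpleGraph.ConnectedComponent.eq.2 (SimpleGraph.Adj.reachable ?_)).symm⟩
  rw [SimpleGraph.compl_adj, coreGraph_adj_iff hs ht]
  exact ⟨fun h' => h (coreClass_eq_iff.1 (congrArg Subtype.val h')).meets, fun h' => h h'.2⟩

theorem InComp.meets (hi : InComp i s) (hj : InComp j t) (hij : i ≠ j) : Meets s t := by
  by_contra h
  exact hij ((hi.of_not_meets hj.irred h).unique hj)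

/-- A coconnected component is the orbit of any of its elements under the relation
"core equivalent or orthogonal" on noncore irreducibles. -/
theorem InComp.induction {p : S → Prop} (hs : InComp i s) (ht : InComp i t) (base : p s)
    (step : ∀ u v, u ∈ noncoreIrred S → v ∈ noncoreIrred S → p u → (CoreEquiv u v ∨ ¬ Meets u v) →
      p v) : p t := by
  obtain ⟨hs, rfl⟩ := hs
  obtain ⟨ht, h⟩ := ht
  have h := (SimpleGraph.reachable_iff_reflTransGen _ _).1
    (SimpleGraph.ConnectedComponent.eq.1 h.symm)
  have key : ∀ v : coreVertices S, Relation.ReflTransGen (coreGraph S)ᶜ.Adj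
      ⟨coreClass s, Set.mem_image_of_mem _ hs⟩ v →
      ∀ t (ht : t ∈ noncoreIrred S), coreClass t = (v : CoreQuotient S) → p t := by
    intro v hv
    induction hv with
    | refl => exact fun t ht h => step s t hs ht base (.inl (coreClass_eq_iff.1 h.symm))
    | @tail u v _ huv ih =>
      intro t ht h
      obtain ⟨_, u, hu, rfl⟩ := u
      obtain ⟨_, v, hv, rfl⟩ := v
      refine step v t hv ht (step u v hu hv (ih u hu rfl) (.inr fun hm => ?_))
        (.inl (coreClass_eq_iff.1 h.symm))
      rw [SimpleGraph.compl_adj] at huv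
      exact huv.2 ((coreGraph_adj_iff hu hv).2
        ⟨fun h => huv.1 (Subtype.ext (coreClass_eq_iff.2 h)), hm⟩)
  exact key _ h t ht rfl

theorem componentVertices_eq (i : CoComponent (coreGraph S)) :
    componentVertices i = coreClass '' {s : S | InComp i s} := by
  ext x
  constructor
  · rintro ⟨⟨_, s, hs, rfl⟩, h, rfl⟩
    exact ⟨s, ⟨hs, h⟩, rfl⟩
  · rintro ⟨s, ⟨hs, h⟩, rfl⟩
    exact ⟨⟨coreClass s, Set.mem_image_of_mem _ hs⟩, h, rfl⟩

theorem coreClass_mem_componentVertices : coreClass s ∈ componentVertices i ↔ InComp i s := by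
  rw [componentVertices_eq]
  exact ⟨fun ⟨_, h, e⟩ => h.of_coreEquiv (coreClass_eq_iff.1 e), fun h => ⟨s, h, rfl⟩⟩

theorem componentsEdgeFree_iff : ComponentsEdgeFree S ↔
    ∀ (i : CoComponent (coreGraph S)) (s t : S), InComp i s → InComp i t → Meets s t →
      CoreEquiv s t := by
  constructor
  · rintro h i s t ⟨hs, hi⟩ ⟨ht, hi'⟩ hm
    by_contra hne
    have := (coreGraph_adj_iff hs ht).2 ⟨hne, hm⟩
    have h' : ((coreGraph S).induce i.supp).Adj ⟨_, hi⟩ ⟨_, hi'⟩ := this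
    rw [h i] at h'
    exact h'
  · intro h i
    ext ⟨⟨_, s, hs, rfl⟩, hi⟩ ⟨⟨_, t, ht, rfl⟩, hi'⟩
    simp only [SimpleGraph.bot_adj, iff_false]
    intro hadj
    have := (coreGraph_adj_iff hs ht).1 hadj
    exact this.1 (h i s t ⟨hs, hi⟩ ⟨ht, hi'⟩ this.2)

theorem balancedFactorization_iff : BalancedFactorization S ↔
    ∀ (i j : CoComponent (coreGraph S)) (s t : S), i ≠ j → InComp i s → InComp j t →
      ∃ t' s', InComp j t' ∧ InComp i s' ∧ IsLcm s t t' s' := by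
  constructor
  · rintro h i j s t hij ⟨hs, rfl⟩ ⟨ht, rfl⟩
    obtain ⟨s', t', h₁, h₂, h₃, h₄⟩ := h _ _ hij
    exact ⟨t', s', ⟨t'.2, h₄⟩, ⟨s'.2, h₃⟩, isLcm_iff.2 ⟨h₁, h₂⟩⟩
  · intro h s t hst
    obtain ⟨t', s', ⟨ht, ht'⟩, ⟨hs, hs'⟩, hl⟩ :=
      h _ _ s t hst (inComp_coIndex s) (inComp_coIndex t)
    exact ⟨⟨s', hs⟩, ⟨t', ht⟩, (isLcm_iff.1 hl).1, hl.1, hs', ht'⟩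

/-- The core acts on the core graph by graph automorphisms. -/
theorem inComp_core_mul_iff_of_inComp {a s t : S} (ha : a ∈ core S) (hs : InComp i s)
    (hs' : InComp j (a * s)) : InComp i t ↔ InComp j (a * t) := by
  constructor
  · intro ht
    refine hs.induction (p := fun t => InComp j (a * t)) ht hs' fun u v _ hv hu huv => ?_
    obtain h | h := huv
    · exact hu.of_coreEquiv (coreEquiv_mul_left_iff.2 h)
    · exact hu.of_not_meets ((core_mul_mem_noncoreIrred_iff ha).2 hv)
        (fun h' => h (meets_mul_left_iff.1 h'))
  · intro ht
    -- Every class is of the form `[a * r]`, so the induction runs over the translates.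
    have key : ∀ r, CoreEquiv (a * r) (a * t) → InComp i r := by
      refine hs'.induction (p := fun u => ∀ r, CoreEquiv (a * r) u → InComp i r) ht
        (fun r h => hs.of_coreEquiv (coreEquiv_mul_left_iff.1 h).symm) ?_
      intro u v hu hv ih huv r hr
      obtain h | h := huv
      · exact ih r (hr.trans h.symm)
      · obtain ⟨x, b, hb, hl⟩ := exists_core_isLcm ha u
        have hx : CoreEquiv (a * x) u := hl.1 ▸ coreEquiv_mul_core u hb
        refine (ih x hx).of_not_meets
          ((core_mul_mem_noncoreIrred_iff ha).1 (hr.symm.mem_noncoreIrred hv)) fun hm => ?_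
        exact h ((meets_mul_left_iff.2 hm).of_coreEquiv hx hr)
    exact key t (CoreEquiv.refl _)

theorem actionPreservesComponents_iff : ActionPreservesComponents S ↔
    ∀ a ∈ core S, ∀ (i : CoComponent (coreGraph S)) (s : S), InComp i s → InComp i (a * s) := by
  constructor
  · intro h a ha i s hs
    exact coreClass_mem_componentVertices.1
      ((h ⟨a, ha⟩ i).mapsTo (coreClass_mem_componentVertices.2 hs))
  · intro h a i
    refine ⟨?_, ?_, ?_⟩
    · intro x hx
      obtain ⟨s, rfl⟩ := coreClass_surjective x
      exact coreClass_mem_componentVertices.2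
        (h a a.2 i s (coreClass_mem_componentVertices.1 hx))
    · intro x _ y _ hxy
      obtain ⟨s, rfl⟩ := coreClass_surjective x
      obtain ⟨t, rfl⟩ := coreClass_surjective y
      exact coreClass_eq_iff.2 (coreEquiv_mul_left_iff.1 (coreClass_eq_iff.1 hxy))
    · intro x hx
      obtain ⟨s, rfl⟩ := coreClass_surjective x
      obtain ⟨r, b, hb, hl⟩ := exists_core_isLcm a.2 s
      have hr : CoreEquiv ((a : S) * r) s := hl.1 ▸ coreEquiv_mul_core s hb
      refine ⟨coreClass r, coreClass_mem_componentVertices.2 ?_, coreClass_eq_iff.2 hr⟩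
      have hs := coreClass_mem_componentVertices.1 hx
      have hr' := hs.of_coreEquiv hr.symm
      obtain ⟨j, hj⟩ := exists_inComp ((core_mul_mem_noncoreIrred_iff a.2).1 hr'.irred)
      obtain rfl := (h a a.2 j r hj).unique hr'
      exact hj

/-- If there are at least two coconnected components, then `α` is seen to preserve each of them
by comparing the least common multiples of `s`, `t` and of `s * a`, `t`.  A single component is
preserved because `α` acts by graph automorphisms. -/
theorem BalancedFactorization.actionPreservesComponents (h : BalancedFactorization S) :
    ActionPreservesComponents S := by
  rw [balancedFactorization_iff] at h
  rw [actionPreservesComponents_iff]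
  intro a ha i t ht
  obtain ⟨j, hj⟩ := exists_inComp ((core_mul_mem_noncoreIrred_iff ha).2 ht.irred)
  by_cases hij : i = j
  · exact hij ▸ hj
  obtain ⟨s, hs⟩ := coIndex_surjective j
  obtain ⟨t', s', ht', hs', hl⟩ := h j i s t (Ne.symm hij) hs ht
  obtain ⟨t'', s'', ht'', hs'', hl'⟩ := h j i (s * a) t (Ne.symm hij)
    (hs.of_coreEquiv (coreEquiv_mul_core s ha).symm) ht
  have key : CoreEquiv t' (a * t'') := by
    obtain ⟨w, hw, hw'⟩ := hl.2 (a * t'') s'' (by rw [← mul_assoc, hl'.1])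
    refine ⟨w, ?_, 1, one_mem _, by rw [mul_one, hw]⟩
    refine ((hs''.irred.2 1 (one_mem _) s' w (by rw [mul_one, hw'])).resolve_left hs'.irred.1)
  exact (inComp_core_mul_iff_of_inComp ha ht'' (ht'.of_coreEquiv key)).1 ht

end Basics

/-! ### Generalized scales: necessary conditions -/

section Scale

variable {S : Type*} [Monoid S] [IsRightLCM S]

/-- A first factor may be exchanged for a core equivalent one, at the expense of multiplying the
second factor by core elements on the left. -/
theorem CoreEquiv.exists_mul {t t' : S} (h : CoreEquiv t t') (r : S) :
    ∃ a ∈ core S, ∃ b ∈ core S, ∃ q, CoreEquiv r (a * q) ∧ CoreEquiv (t * r) (t' * (b * q)) := by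
  obtain ⟨a, ha, b, hb, hab⟩ := h
  obtain ⟨q, c, hc, hl⟩ := exists_core_isLcm ha r
  have hr : CoreEquiv r (a * q) := hl.1 ▸ (coreEquiv_mul_core r hc).symm
  refine ⟨a, ha, b, hb, q, hr, (coreEquiv_mul_left_iff.2 hr).trans ?_⟩
  rw [← mul_assoc, hab, mul_assoc]
  exact .refl _

/-- An injective self-relation on a set with finitely many core equivalence classes is surjective
up to core equivalence. -/
theorem exists_of_finite_classes {A : Set S} (hA : (coreClass '' A).Finite) {R : S → S → Prop}
    (h₁ : ∀ x ∈ A, ∃ t ∈ A, R x t)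
    (h₂ : ∀ x ∈ A, ∀ x' ∈ A, ∀ t ∈ A, ∀ t' ∈ A, R x t → R x' t' → CoreEquiv t t' →
      CoreEquiv x x') {t : S} (ht : t ∈ A) : ∃ x ∈ A, ∃ t' ∈ A, CoreEquiv t' t ∧ R x t' := by
  choose! f hf hR using h₁
  have hrep : ∀ c ∈ coreClass '' A, ∃ x ∈ A, coreClass x = c := fun c hc => hc
  choose! rep hrep hrep' using hrep
  have hmaps : Set.MapsTo (fun c => coreClass (f (rep c))) (coreClass '' A) (coreClass '' A) :=
    fun c hc => Set.mem_image_of_mem _ (hf _ (hrep c hc))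
  have hinj : Set.InjOn (fun c => coreClass (f (rep c))) (coreClass '' A) := by
    intro c hc d hd hcd
    rw [← hrep' c hc, ← hrep' d hd]
    exact coreClass_eq_iff.2 (h₂ _ (hrep c hc) _ (hrep d hd) _ (hf _ (hrep c hc)) _
      (hf _ (hrep d hd)) (hR _ (hrep c hc)) (hR _ (hrep d hd)) (coreClass_eq_iff.1 hcd))
  have hsurj := Set.Finite.eq_of_subset_of_encard_le' hA hmaps.image_subset
    hinj.encard_image.ge
  obtain ⟨c, hc, h⟩ := hsurj.ge (Set.mem_image_of_mem _ ht)
  exact ⟨rep c, hrep c hc, _, hf _ (hrep c hc), coreClass_eq_iff.1 h, hR _ (hrep c hc)⟩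

namespace IsGeneralizedScale

variable {N : S →* ℕ+}

theorem coreEquiv_of_meets (hN : IsGeneralizedScale N) {s t : S} (h : N s = N t)
    (hm : Meets s t) : CoreEquiv s t :=
  (hN.equiv_or_orthogonal s t h).resolve_right (not_not.2 hm)

theorem map_eq_one_iff (hN : IsGeneralizedScale N) {a : S} : N a = 1 ↔ a ∈ core S := by
  constructor
  · intro h
    have hc := hN.card_fiber 1 ⟨1, map_one N⟩
    rw [PNat.one_coe, Nat.cast_one, Set.encard_eq_one] at hc
    obtain ⟨x, hx⟩ := hc
    have h₁ : coreClass a = x := Set.mem_singleton_iff.1 (hx ▸ ⟨a, h, rfl⟩)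
    have h₂ : coreClass (1 : S) = x := Set.mem_singleton_iff.1 (hx ▸ ⟨1, map_one N, rfl⟩)
    exact (coreClass_eq_iff.1 (h₂.trans h₁.symm)).mem_core (one_mem _)
  · intro h
    have hc := hN.card_fiber (N a) ⟨a, rfl⟩
    have : coreClass '' {s : S | N s = N a} = {coreClass a} := by
      refine Set.eq_singleton_iff_unique_mem.2 ⟨⟨a, rfl, rfl⟩, ?_⟩
      rintro _ ⟨s, hs, rfl⟩
      exact coreClass_eq_iff.2 (hN.coreEquiv_of_meets hs (h s).symm)
    rw [this, Set.encard_singleton] at hc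
    exact PNat.eq (by exact_mod_cast hc.symm)

theorem map_eq_of_coreEquiv (hN : IsGeneralizedScale N) {s t : S} (h : CoreEquiv s t) :
    N s = N t := by
  obtain ⟨a, ha, b, hb, hab⟩ := h
  have := congrArg N hab
  rwa [map_mul, map_mul, hN.map_eq_one_iff.2 ha, hN.map_eq_one_iff.2 hb, mul_one, mul_one] at this

/-- Every factorization of `N s` in the image of `N` lifts to a factorization of `s`. -/
theorem exists_coreEquiv_mul (hN : IsGeneralizedScale N) {s : S} {n m : ℕ+}
    (hn : n ∈ Set.range N) (hm : m ∈ Set.range N) (h : N s = n * m) :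
    ∃ t r, N t = n ∧ N r = m ∧ CoreEquiv s (t * r) := by
  obtain ⟨t, ht, hst⟩ := hN.exists_meets s n hn
  obtain ⟨x, y, hxy⟩ := meets_iff.1 hst
  obtain ⟨r, hr, hyr⟩ := hN.exists_meets y m hm
  obtain ⟨u, v, huv⟩ := meets_iff.1 hyr
  refine ⟨t, r, ht, hr, hN.coreEquiv_of_meets (by rw [map_mul, ht, hr, h]) ?_⟩
  exact Meets.of_eq (x := x * u) (y := v)
    (by rw [← mul_assoc, hxy, mul_assoc, huv, mul_assoc])

/-- The irreducible elements of the image of `N`. -/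
def Irred (N : S →* ℕ+) (n : ℕ+) : Prop :=
  n ∈ Set.range N ∧ n ≠ 1 ∧ ∀ a ∈ Set.range N, ∀ b ∈ Set.range N, n = a * b → a = 1 ∨ b = 1

theorem mem_noncoreIrred_iff (hN : IsGeneralizedScale N) {s : S} :
    s ∈ noncoreIrred S ↔ Irred N (N s) := by
  constructor
  · rintro ⟨h₁, h₂⟩
    refine ⟨⟨s, rfl⟩, fun h => h₁ (hN.map_eq_one_iff.1 h), fun a ha b hb hab => ?_⟩
    obtain ⟨t, r, rfl, rfl, c, hc, d, hd, h⟩ := hN.exists_coreEquiv_mul ha hb hab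
    rw [hN.map_eq_one_iff, hN.map_eq_one_iff]
    exact (h₂ c hc t (r * d) (by rw [h, mul_assoc])).imp_right mul_left_mem_core
  · rintro ⟨-, h₁, h₂⟩
    refine ⟨fun h => h₁ (hN.map_eq_one_iff.2 h), fun a ha t r h => ?_⟩
    rw [← hN.map_eq_one_iff, ← hN.map_eq_one_iff]
    refine h₂ _ ⟨t, rfl⟩ _ ⟨r, rfl⟩ ?_
    rw [← map_mul, ← h, map_mul, hN.map_eq_one_iff.2 ha, mul_one]

/-- Least common multiples of elements with distinct irreducible scales are as small as possible:
their scale is the product. -/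
theorem map_isLcm (hN : IsGeneralizedScale N) {s t x y : S} (hs : Irred N (N s))
    (ht : Irred N (N t)) (hst : N s ≠ N t) (hl : IsLcm s t x y) : N x = N t ∧ N y = N s := by
  obtain ⟨v, hv, hm⟩ := hN.exists_meets (s * x) (N s * N t) ⟨s * t, map_mul N s t⟩
  -- `v` meets `s`, so it is a multiple of `s` up to the core; the same holds for `t`.
  have key : ∀ s t : S, Meets s v → N v = N s * N t → ∃ a ∈ core S, ∃ z, v * a = s * z := by
    intro s t hm hv
    obtain ⟨s', x', hs', -, h⟩ := hN.exists_coreEquiv_mul ⟨s, rfl⟩ ⟨t, rfl⟩ hv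
    obtain ⟨p, q, hpq⟩ := meets_iff.1 (hm.of_coreEquiv (.refl s) h)
    obtain ⟨a, -, b, -, q', -, h'⟩ := (hN.coreEquiv_of_meets (t := s) hs'
      (Meets.of_eq (x := x' * q) (by rw [← mul_assoc, hpq]))).exists_mul x'
    obtain ⟨c, hc, d, -, e⟩ := h.trans h'
    exact ⟨c, hc, b * q' * d, by rw [e, mul_assoc]⟩
  obtain ⟨p, q, hpq⟩ := meets_iff.1 hm
  obtain ⟨a, ha, z, hz⟩ := key s t (Meets.of_eq (x := x * p) (by rw [← mul_assoc, hpq])) hv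
  obtain ⟨b, hb, z', hz'⟩ := key t s
    (Meets.of_eq (x := y * p) (by rw [← mul_assoc, ← hl.1, hpq])) (by rw [hv, mul_comm])
  obtain ⟨c, hc, d, -, hcd⟩ := coreEquiv_of_mem_core ha hb
  obtain ⟨k, hk, hk'⟩ := hl.2 (z * c) (z' * d)
    (by rw [← mul_assoc, ← hz, mul_assoc, hcd, ← mul_assoc, hz', mul_assoc])
  have e₁ : N t = N x * N k := by
    have := congrArg N (show v * (a * c) = s * (x * k) by rw [← hk, ← mul_assoc, hz, mul_assoc])
    rw [map_mul, hN.map_eq_one_iff.2 (mul_mem ha hc), mul_one, hv, map_mul, map_mul] at this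
    exact mul_left_cancel this
  have e₂ := congrArg N hl.1
  rw [map_mul, map_mul] at e₂
  obtain hx | hk₁ := ht.2.2 _ ⟨x, rfl⟩ _ ⟨k, rfl⟩ e₁
  · rw [hx, mul_one] at e₂
    obtain h | h := hs.2.2 _ ⟨t, rfl⟩ _ ⟨y, rfl⟩ e₂
    · exact absurd h ht.2.1
    · rw [h, mul_one] at e₂
      exact absurd e₂ hst
  · rw [hk₁, mul_one] at e₁
    refine ⟨e₁.symm, ?_⟩
    rw [← e₁, mul_comm] at e₂
    exact (mul_left_cancel e₂).symm

theorem finite_fiber (hN : IsGeneralizedScale N) {n : ℕ+} (hn : n ∈ Set.range N) :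
    (coreClass '' {s : S | N s = n}).Finite := by
  rw [← Set.encard_ne_top_iff, hN.card_fiber n hn]
  exact ENat.natCast_ne_top _

/-- Elements with distinct irreducible scales meet.  For fixed `s`, every `x` with `N x = N t`
has some `t'` with `N t' = N t` that meets `s * x`, and the class of `t'` determines that of `x`.
As there are only finitely many classes, every class arises from some `x`. -/
theorem meets_of_irred (hN : IsGeneralizedScale N) {s t : S} (hs : Irred N (N s))
    (ht : Irred N (N t)) (hst : N s ≠ N t) : Meets s t := by
  obtain ⟨x, -, t', -, htt', hR⟩ := exists_of_finite_classes
    (hN.finite_fiber ⟨t, rfl⟩) (R := fun x t => Meets (s * x) t)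
    (fun x _ => by
      obtain ⟨t', h, h'⟩ := hN.exists_meets (s * x) (N t) ⟨t, rfl⟩
      exact ⟨t', h, h'⟩)
    (by
      intro x hx x' hx' u hu u' hu' h h' huu'
      obtain ⟨p, q, hpq⟩ := meets_iff.1 h
      obtain ⟨p', q', hpq'⟩ := meets_iff.1 (h'.of_coreEquiv (.refl _) huu'.symm)
      rw [mul_assoc] at hpq hpq'
      obtain ⟨X, Y, hl⟩ := (Meets.of_eq hpq).exists_isLcm
      have hu : N u = N t := hu
      have hX : N X = N t := by
        rw [← hu]
        exact (hN.map_isLcm hs (hu ▸ ht) (hu ▸ hst) hl).1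
      obtain ⟨w, hw, -⟩ := hl.2 _ _ hpq
      obtain ⟨w', hw', -⟩ := hl.2 _ _ hpq'
      exact (hN.coreEquiv_of_meets (hx.trans hX.symm) (Meets.of_eq hw)).trans
        (hN.coreEquiv_of_meets (hx'.trans hX.symm) (Meets.of_eq hw')).symm)
    (show t ∈ {u : S | N u = N t} from rfl)
  obtain ⟨p, q, hpq⟩ := meets_iff.1 (hR.of_coreEquiv (.refl _) htt')
  exact Meets.of_eq (x := x * p) (by rw [← mul_assoc, hpq])

theorem inComp_iff (hN : IsGeneralizedScale N) {i : CoComponent (coreGraph S)} {s t : S}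
    (hs : InComp i s) : InComp i t ↔ N t = N s := by
  constructor
  · intro ht
    refine hs.induction (p := fun t => N t = N s) ht rfl fun u v hu hv e h => ?_
    obtain h | h := h
    · rw [← e, hN.map_eq_of_coreEquiv h]
    · by_contra hne
      exact h (hN.meets_of_irred (hN.mem_noncoreIrred_iff.1 hu) (hN.mem_noncoreIrred_iff.1 hv)
        (fun h' => hne (h' ▸ e)))
  · intro h
    have ht : t ∈ noncoreIrred S := by
      rw [hN.mem_noncoreIrred_iff, h, ← hN.mem_noncoreIrred_iff]
      exact hs.irred
    by_cases hm : Meets s t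
    · exact hs.of_coreEquiv (hN.coreEquiv_of_meets h.symm hm)
    · exact hs.of_not_meets ht hm

theorem componentSize_eq (hN : IsGeneralizedScale N) {i : CoComponent (coreGraph S)} {s : S}
    (hs : InComp i s) : componentSize i = ((N s : ℕ) : ℕ∞) := by
  rw [componentSize, componentVertices_eq, ← hN.card_fiber _ ⟨s, rfl⟩]
  congr 2
  ext t
  exact hN.inComp_iff hs

theorem componentsEdgeFree (hN : IsGeneralizedScale N) : ComponentsEdgeFree S :=
  componentsEdgeFree_iff.2 fun _ _ _ hs ht hm =>
    hN.coreEquiv_of_meets ((hN.inComp_iff hs).1 ht).symm hm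

theorem balancedFactorization (hN : IsGeneralizedScale N) : BalancedFactorization S := by
  refine balancedFactorization_iff.2 fun i j s t hij hs ht => ?_
  have hne : N s ≠ N t := fun h => hij (((hN.inComp_iff hs).2 h.symm).unique ht)
  obtain ⟨x, y, hl⟩ := (hs.meets ht hij).exists_isLcm
  obtain ⟨h₁, h₂⟩ := hN.map_isLcm (hN.mem_noncoreIrred_iff.1 hs.irred)
    (hN.mem_noncoreIrred_iff.1 ht.irred) hne hl
  exact ⟨x, y, (hN.inComp_iff ht).2 h₁, (hN.inComp_iff hs).2 h₂, hl⟩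

theorem noncoreFactorable (hN : IsGeneralizedScale N) : NoncoreFactorable S := by
  intro s hs
  induction hn : N s using PNat.strongInductionOn generalizing s with
  | _ n ih =>
    subst hn
    by_cases hI : s ∈ noncoreIrred S
    · exact ⟨[s], by simpa using hI, by simpa using CoreEquiv.refl s⟩
    have h1 : N s ≠ 1 := fun h => hs (hN.map_eq_one_iff.1 h)
    rw [hN.mem_noncoreIrred_iff, Irred] at hI
    push Not at hI
    obtain ⟨a, ha, b, hb, hab, ha1, hb1⟩ := hI ⟨s, rfl⟩ h1
    obtain ⟨t, r, rfl, rfl, h⟩ := hN.exists_coreEquiv_mul ha hb hab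
    have lt_mul : ∀ a b : ℕ+, b ≠ 1 → a < a * b := fun a b hb =>
      lt_mul_of_one_lt_right' a (lt_of_le_of_ne one_le hb.symm)
    obtain ⟨l, hl, hl'⟩ := ih (N t) (by rw [hab]; exact lt_mul _ _ hb1) t
      (fun h => ha1 (hN.map_eq_one_iff.2 h)) rfl
    obtain ⟨c, hc, d, hd, q, h₁, h₂⟩ := hl'.exists_mul r
    have hq : N (d * q) = N r := by
      rw [hN.map_eq_of_coreEquiv h₁, map_mul, map_mul, hN.map_eq_one_iff.2 hc,
        hN.map_eq_one_iff.2 hd]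
    obtain ⟨l', hl₁, hl₁'⟩ := ih (N (d * q)) (by rw [hq, hab, mul_comm]; exact lt_mul _ _ ha1)
      (d * q) (fun h => hb1 (hq ▸ hN.map_eq_one_iff.2 h)) rfl
    refine ⟨l ++ l', fun x hx => (List.mem_append.1 hx).elim (hl x) (hl₁ x), ?_⟩
    rw [List.prod_append]
    exact h.trans (h₂.trans (coreEquiv_mul_left_iff.2 hl₁'))

/-- For irreducible `p`, the scales of elements `t` that have a least common multiple `t * y` with
`N y = p` with each `s` such that `N s = p`.  They are not divisible by `p`. -/
def coprimeSubmonoid (N : S →* ℕ+) (p : ℕ+) : Submonoid ℕ+ where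
  carrier := {n | ∃ t, N t = n ∧ ∀ s, N s = p → ∃ x y, N y = p ∧ IsLcm s t x y}
  one_mem' := ⟨1, map_one N, fun s hs => ⟨1, s, hs, by simp,
    fun u v h => ⟨u, (one_mul u).symm, by rw [h, one_mul]⟩⟩⟩
  mul_mem' := by
    rintro _ _ ⟨t, rfl, ht⟩ ⟨t', rfl, ht'⟩
    refine ⟨t * t', map_mul N t t', fun s hs => ?_⟩
    obtain ⟨x, y, hy, hl⟩ := ht s hs
    obtain ⟨x', y', hy', hl'⟩ := ht' y hy
    exact ⟨_, _, hy', hl.comp hl'⟩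

theorem mem_coprimeSubmonoid (hN : IsGeneralizedScale N) {p q : ℕ+} (hp : Irred N p)
    (hq : Irred N q) (hpq : p ≠ q) : q ∈ coprimeSubmonoid N p := by
  obtain ⟨t, rfl⟩ := hq.1
  refine ⟨t, rfl, ?_⟩
  rintro s rfl
  obtain ⟨x, y, hl⟩ := (hN.meets_of_irred hp hq hpq).exists_isLcm
  exact ⟨x, y, (hN.map_isLcm hp hq hpq hl).2, hl⟩

theorem mul_notMem_coprimeSubmonoid (hN : IsGeneralizedScale N) {p n : ℕ+} (hp : Irred N p)
    (hn : n ∈ Set.range N) : p * n ∉ coprimeSubmonoid N p := by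
  rintro ⟨t, ht, h⟩
  obtain ⟨s, r, hs, -, a, ha, b, -, e⟩ := hN.exists_coreEquiv_mul hp.1 hn ht
  obtain ⟨x, y, hy, hl⟩ := h s hs
  obtain ⟨w, -, hw⟩ := hl.2 (r * b) a (by rw [e, mul_assoc])
  exact hp.2.1 (hy ▸ hN.map_eq_one_iff.2 (mul_left_mem_core (hw ▸ ha)))

end IsGeneralizedScale

theorem finsuppProd_eq_multisetProd {I : Type*} (m : I → ℕ+) (f : I →₀ ℕ) :
    (f.prod fun i k => m i ^ k) = ((Finsupp.toMultiset f).map m).prod := by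
  classical
  induction f using Finsupp.induction_linear with
  | zero => simp
  | add f g hf hg =>
    rw [Finsupp.prod_add_index' (fun _ => pow_zero _) (fun _ _ _ => pow_add _ _ _), hf, hg,
      map_add, Multiset.map_add, Multiset.prod_add]
  | single i k => simp [Finsupp.toMultiset_single, Multiset.map_nsmul, Multiset.prod_nsmul]

theorem injective_finsuppProd_iff {I : Type*} (m : I → ℕ+) :
    (Function.Injective fun f : I →₀ ℕ => f.prod fun i k => m i ^ k) ↔
      Function.Injective fun D : Multiset I => (D.map m).prod := by
  classical
  simp only [finsuppProd_eq_multisetProd]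
  exact Function.Injective.of_comp_iff' (fun D : Multiset I => (D.map m).prod)
    (Multiset.toFinsupp (α := I)).symm.bijective

/-- Unique factorization follows once each `m i` is prime relative to the submonoid generated by
the family `m`. -/
theorem injective_multisetProd {I : Type*} (m : I → ℕ+)
    (h : ∀ i (D E : Multiset I), i ∉ D → m i * (E.map m).prod ≠ (D.map m).prod) :
    Function.Injective fun D : Multiset I => (D.map m).prod := by
  intro D
  induction D using Multiset.induction with
  | empty =>
    intro E hE
    by_contra hne
    obtain ⟨i, hi⟩ := Multiset.exists_mem_of_ne_zero (Ne.symm hne)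
    obtain ⟨E, rfl⟩ := Multiset.exists_cons_of_mem hi
    exact h i 0 E (Multiset.notMem_zero i) (by simpa using hE.symm)
  | cons i D ih =>
    intro E hE
    by_cases hi : i ∈ E
    · obtain ⟨E, rfl⟩ := Multiset.exists_cons_of_mem hi
      rw [ih (a₂ := E) (by simpa using hE)]
    · exact absurd (by simpa using hE) (h i E D hi)

theorem IsGeneralizedScale.freelyGeneratesNontrivial {N : S →* ℕ+} (hN : IsGeneralizedScale N) :
    FreelyGeneratesNontrivial (componentSize (S := S)) := by
  choose r hr using coIndex_surjective (S := S)
  have hirr : ∀ i, IsGeneralizedScale.Irred N (N (r i)) := fun i =>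
    hN.mem_noncoreIrred_iff.1 (hr i).irred
  refine ⟨fun i => N (r i), fun i => hN.componentSize_eq (hr i), ?_, ?_⟩
  · refine (injective_finsuppProd_iff _).2 (injective_multisetProd _ fun i D E hi e => ?_)
    have hE : (E.map fun i => N (r i)).prod ∈ MonoidHom.mrange N :=
      Submonoid.multiset_prod_mem _ _ fun _ h => by
        obtain ⟨j, -, rfl⟩ := Multiset.mem_map.1 h
        exact ⟨r j, rfl⟩
    refine hN.mul_notMem_coprimeSubmonoid (hirr i) hE (e ▸ ?_)
    refine Submonoid.multiset_prod_mem _ _ fun _ h => ?_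
    obtain ⟨j, hj, rfl⟩ := Multiset.mem_map.1 h
    refine hN.mem_coprimeSubmonoid (hirr i) (hirr j) fun h => hi ?_
    exact ((hN.inComp_iff (hr i)).2 h.symm).unique (hr j) ▸ hj
  · intro hbot
    refine hN.nontrivial (MonoidHom.ext fun s => ?_)
    rw [MonoidHom.one_apply, hN.map_eq_one_iff]
    by_contra hs
    obtain ⟨l, hl, h⟩ := hN.noncoreFactorable s hs
    cases l with
    | nil => exact hs (h.symm.mem_core (one_mem _))
    | cons x l =>
      obtain ⟨i, hi⟩ := exists_inComp (hl x (by simp))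
      have := Submonoid.subset_closure (Set.mem_range_self (f := fun i => N (r i)) i)
      rw [hbot] at this
      exact (hirr i).2.1 this

end Scale

/-! ### Generalized scales: sufficient conditions -/

section Degree

variable {S : Type*} [Monoid S] [IsRightLCM S]

/-- `DegWord D u`: the element `u` is a product of noncore irreducibles, and `D` is the multiset of
their coconnected components. -/
inductive DegWord : Multiset (CoComponent (coreGraph S)) → S → Prop
  | one : DegWord 0 1
  | cons {i : CoComponent (coreGraph S)} {D : Multiset (CoComponent (coreGraph S))} {s u : S} :
      InComp i s → DegWord D u → DegWord (i ::ₘ D) (s * u)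

/-- `HasDeg D s`: up to core equivalence, `s` is a product of noncore irreducibles with multiset of
coconnected components `D`. -/
def HasDeg (D : Multiset (CoComponent (coreGraph S))) (s : S) : Prop :=
  ∃ u, DegWord D u ∧ CoreEquiv s u

variable {D E : Multiset (CoComponent (coreGraph S))} {i : CoComponent (coreGraph S)} {s t u : S}

theorem HasDeg.of_coreEquiv (h : HasDeg D s) (hst : CoreEquiv s t) : HasDeg D t :=
  let ⟨u, hu, hsu⟩ := h
  ⟨u, hu, hst.symm.trans hsu⟩

theorem HasDeg.cons (hs : InComp i s) (ht : HasDeg D t) : HasDeg (i ::ₘ D) (s * t) :=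
  let ⟨_, hu, htu⟩ := ht
  ⟨_, .cons hs hu, coreEquiv_mul_left_iff.2 htu⟩

theorem DegWord.hasDeg (h : DegWord D u) : HasDeg D u := ⟨u, h, .refl u⟩

theorem hasDeg_zero_iff : HasDeg 0 s ↔ s ∈ core S := by
  constructor
  · rintro ⟨u, hu, h⟩
    generalize hD : (0 : Multiset (CoComponent (coreGraph S))) = D at hu
    cases hu with
    | one => exact h.symm.mem_core (one_mem _)
    | cons _ _ => exact absurd hD (Multiset.zero_ne_cons)
  · exact fun h => ⟨1, .one, coreEquiv_of_mem_core h (one_mem _)⟩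

theorem DegWord.eq_zero (h : DegWord D u) (hu : u ∈ core S) : D = 0 := by
  cases h with
  | one => rfl
  | cons hs _ => exact absurd (mul_left_mem_core hu) hs.irred.1

theorem inComp_core_mul_iff (hA : ActionPreservesComponents S) {a : S} (ha : a ∈ core S) :
    InComp i (a * s) ↔ InComp i s := by
  rw [actionPreservesComponents_iff] at hA
  refine ⟨fun h => ?_, hA a ha i s⟩
  obtain ⟨j, hj⟩ := exists_inComp ((core_mul_mem_noncoreIrred_iff ha).1 h.irred)
  exact (hA a ha j s hj).unique h ▸ hj

theorem hasDeg_core_mul_iff (hA : ActionPreservesComponents S) {a : S} (ha : a ∈ core S) :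
    HasDeg D (a * s) ↔ HasDeg D s := by
  constructor
  · rintro ⟨u, hu, h⟩
    have key : ∃ u', DegWord D u' ∧ CoreEquiv u (a * u') := by
      clear h
      induction hu generalizing a with
      | one => exact ⟨1, .one, coreEquiv_of_mem_core (one_mem _) (by simpa using ha)⟩
      | @cons i D s u hs hu ih =>
        obtain ⟨r, b, hb, hl⟩ := exists_core_isLcm ha s
        obtain ⟨u', hu', h⟩ := ih hb
        have hr : InComp i r := by
          rw [← inComp_core_mul_iff hA ha, hl.1]
          exact hs.of_coreEquiv (coreEquiv_mul_core s hb).symm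
        refine ⟨r * u', .cons hr hu', ?_⟩
        rw [← mul_assoc, hl.1, mul_assoc]
        exact coreEquiv_mul_left_iff.2 h
    obtain ⟨u', hu', h'⟩ := key
    exact ⟨u', hu', coreEquiv_mul_left_iff.1 (h.trans h')⟩
  · rintro ⟨u, hu, h⟩
    refine HasDeg.of_coreEquiv ?_ (coreEquiv_mul_left_iff.2 h.symm)
    cases hu with
    | one => exact hasDeg_zero_iff.2 (by simpa using ha)
    | cons hs hu =>
      rw [← mul_assoc]
      exact .cons ((inComp_core_mul_iff hA ha).2 hs) hu.hasDeg

/-- The second factor of a product may be adjusted, without changing its degree, when the first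
factor is replaced by a core equivalent one. -/
theorem HasDeg.exists_mul (hA : ActionPreservesComponents S) {t t' r : S} (hr : HasDeg D r)
    (h : CoreEquiv t t') : ∃ r', HasDeg D r' ∧ CoreEquiv (t * r) (t' * r') := by
  obtain ⟨a, ha, b, hb, q, h₁, h₂⟩ := h.exists_mul r
  refine ⟨b * q, ?_, h₂⟩
  rw [hasDeg_core_mul_iff hA hb, ← hasDeg_core_mul_iff hA ha]
  exact hr.of_coreEquiv h₁

theorem HasDeg.mul (hA : ActionPreservesComponents S) (hs : HasDeg D s) (ht : HasDeg E t) :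
    HasDeg (D + E) (s * t) := by
  obtain ⟨u, hu, h⟩ := hs
  obtain ⟨t', ht', h'⟩ := ht.exists_mul hA h
  refine HasDeg.of_coreEquiv ?_ h'.symm
  clear h h' ht
  induction hu with
  | one => simpa using ht'
  | cons hs _ ih =>
    rw [Multiset.cons_add, mul_assoc]
    exact .cons hs ih

theorem exists_hasDeg (hF : NoncoreFactorable S) (s : S) : ∃ D, HasDeg D s := by
  by_cases hs : s ∈ core S
  · exact ⟨0, hasDeg_zero_iff.2 hs⟩
  obtain ⟨l, hl, h⟩ := hF s hs
  have key : ∃ D, DegWord D l.prod := by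
    clear h
    induction l with
    | nil => exact ⟨0, .one⟩
    | cons x l ih =>
      obtain ⟨D, hD⟩ := ih fun y hy => hl y (by simp [hy])
      obtain ⟨i, hi⟩ := exists_inComp (hl x (by simp))
      exact ⟨i ::ₘ D, by simpa using DegWord.cons hi hD⟩
  obtain ⟨D, hD⟩ := key
  exact ⟨D, _, hD, h⟩

/-- Suppose that the noncore irreducible `s` meets a product `u` of noncore irreducibles.  Then
either `s` can be moved to the front of `u`, up to the core, or `s` is of a different type than the
factors of `u`, and balanced factorization yields the least common multiple. -/
theorem DegWord.split_or_isLcm (hE : ComponentsEdgeFree S) (hB : BalancedFactorization S)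
    (hs : InComp i s) (hu : DegWord D u) (hm : Meets s u) :
    (∃ D' r, D = i ::ₘ D' ∧ HasDeg D' r ∧ CoreEquiv u (s * r)) ∨
      (i ∉ D ∧ ∃ r y, HasDeg D r ∧ InComp i y ∧ IsLcm s u r y) := by
  have hA := hB.actionPreservesComponents
  rw [componentsEdgeFree_iff] at hE
  rw [balancedFactorization_iff] at hB
  induction hu generalizing s with
  | one =>
    exact .inr ⟨Multiset.notMem_zero i, 1, s, DegWord.one.hasDeg, hs, by simp,
      fun u v h => ⟨u, (one_mul u).symm, by rw [h, one_mul]⟩⟩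
  | @cons j D t u ht hu ih =>
    obtain ⟨p, q, hpq⟩ := meets_iff.1 hm
    by_cases hij : i = j
    · subst hij
      have hts := hE i t s ht hs (Meets.of_eq (x := u * q) (y := p) (by rw [hpq, mul_assoc]))
      obtain ⟨r, hr, h⟩ := hu.hasDeg.exists_mul hA hts
      exact .inl ⟨D, r, rfl, hr, h⟩
    · obtain ⟨t', s', ht', hs', hl⟩ := hB i j s t hij hs ht
      obtain ⟨k, -, hk⟩ := hl.2 p (u * q) (by rw [hpq, mul_assoc])
      obtain ⟨D', r, rfl, hr, h⟩ | ⟨hi, r, y, hr, hy, hl'⟩ := ih hs' (Meets.of_eq hk.symm)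
      · refine .inl ⟨j ::ₘ D', t' * r, Multiset.cons_swap _ _ _, .cons ht' hr, ?_⟩
        rw [← mul_assoc, hl.1, mul_assoc]
        exact coreEquiv_mul_left_iff.2 h
      · exact .inr ⟨by simp [hij, hi], t' * r, y, .cons ht' hr, hy, hl.comp hl'⟩

theorem HasDeg.split (hE : ComponentsEdgeFree S) (hB : BalancedFactorization S)
    (hs : InComp i s) (ht : HasDeg D t) (h : (Meets s t ∧ i ∈ D) ∨ ∃ r, CoreEquiv t (s * r)) :
    ∃ D' r, D = i ::ₘ D' ∧ HasDeg D' r ∧ CoreEquiv t (s * r) := by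
  obtain ⟨u, hu, htu⟩ := ht
  have hm : Meets s u := by
    obtain h | ⟨r, h⟩ := h
    · exact h.1.of_coreEquiv (.refl s) htu
    · obtain ⟨x, y, hxy⟩ := meets_iff.1 (htu.symm.trans h).meets
      exact Meets.of_eq (x := r * y) (y := x) (by rw [hxy, mul_assoc])
  obtain ⟨D', r, rfl, hr, h'⟩ | ⟨hi, r, y, -, hy, hl⟩ := hu.split_or_isLcm hE hB hs hm
  · exact ⟨D', r, rfl, hr, htu.trans h'⟩
  · exfalso
    obtain h | ⟨r', h⟩ := h
    · exact hi h.2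
    · obtain ⟨a, ha, b, -, hab⟩ := htu.symm.trans h
      obtain ⟨w, -, rfl⟩ := hl.2 (r' * b) a (by rw [hab, mul_assoc])
      exact hy.irred.1 (mul_left_mem_core ha)

theorem HasDeg.unique (hE : ComponentsEdgeFree S) (hB : BalancedFactorization S)
    (hD : HasDeg D s) (hD' : HasDeg E s) : D = E := by
  obtain ⟨u, hu, h⟩ := hD
  replace hD' := hD'.of_coreEquiv h
  clear h
  induction hu generalizing E with
  | one =>
    obtain ⟨v, hv, h⟩ := hD'
    exact (hv.eq_zero (h.mem_core (one_mem _))).symm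
  | cons hs hu ih =>
    obtain ⟨E, r, rfl, hr, h⟩ := hD'.split hE hB hs (.inr ⟨_, .refl _⟩)
    rw [ih (hr.of_coreEquiv (coreEquiv_mul_left_iff.1 h).symm)]

/-- As the components are finite, every element meets some member of each component. -/
theorem exists_inComp_meets (hE : ComponentsEdgeFree S) (hB : BalancedFactorization S)
    (hF : NoncoreFactorable S) (hfin : ∀ i : CoComponent (coreGraph S), componentSize i ≠ ⊤)
    (i : CoComponent (coreGraph S)) (t : S) : ∃ s, InComp i s ∧ Meets s t := by
  obtain ⟨D, u, hu, h⟩ := exists_hasDeg hF t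
  suffices ∃ s, InComp i s ∧ Meets s u from
    this.imp fun s hs => ⟨hs.1, hs.2.of_coreEquiv (.refl s) h.symm⟩
  clear h
  rw [componentsEdgeFree_iff] at hE
  rw [balancedFactorization_iff] at hB
  induction hu with
  | one =>
    obtain ⟨s, hs⟩ := coIndex_surjective i
    exact ⟨s, hs, (meets_one_left s).symm⟩
  | @cons j D t u ht hu ih =>
    by_cases hij : i = j
    · subst hij
      exact ⟨t, ht, Meets.of_eq (x := u) (y := 1) (by simp)⟩
    obtain ⟨s', hs', hm⟩ := ih
    have hA : (coreClass '' {s : S | InComp i s}).Finite := by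
      rw [← componentVertices_eq, ← Set.encard_ne_top_iff]
      exact hfin i
    obtain ⟨s, hs, y, -, hys, x, hl⟩ := exists_of_finite_classes hA
      (R := fun s y => ∃ x, s * x = t * y)
      (fun s hs => by
        obtain ⟨x, y, -, hy, hl⟩ := hB i j s t hij hs ht
        exact ⟨y, hy, x, hl.1⟩)
      (fun s hs r hr y _ y' _ ⟨x, hx⟩ ⟨x', hx'⟩ hyy => by
        have := (coreEquiv_mul_left_iff (a := t)).2 hyy
        obtain ⟨a, -, b, -, hab⟩ := this
        refine hE i s r hs hr (Meets.of_eq (x := x * a) (y := x' * b) ?_)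
        rw [← mul_assoc, hx, hab, ← hx', mul_assoc])
      (show s' ∈ {s : S | InComp i s} from hs')
    obtain ⟨p, q, hpq⟩ := meets_iff.1 (hm.of_coreEquiv hys.symm (.refl u))
    exact ⟨s, hs, Meets.of_eq (x := x * p) (y := q)
      (by rw [← mul_assoc, hl, mul_assoc, hpq, mul_assoc])⟩

theorem HasDeg.exists_split (hE : ComponentsEdgeFree S) (hB : BalancedFactorization S)
    (hF : NoncoreFactorable S) (hfin : ∀ i : CoComponent (coreGraph S), componentSize i ≠ ⊤)
    (ht : HasDeg (i ::ₘ D) t) : ∃ s r, InComp i s ∧ HasDeg D r ∧ CoreEquiv t (s * r) := by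
  obtain ⟨s, hs, hm⟩ := exists_inComp_meets hE hB hF hfin i t
  obtain ⟨D', r, h, hr, h'⟩ := ht.split hE hB hs (.inl ⟨hm, Multiset.mem_cons_self i D⟩)
  rw [Multiset.cons_inj_right] at h
  exact ⟨s, r, hs, h ▸ hr, h'⟩

theorem HasDeg.coreEquiv_of_meets (hE : ComponentsEdgeFree S) (hB : BalancedFactorization S)
    (hs : HasDeg D s) (ht : HasDeg D t) (hm : Meets s t) : CoreEquiv s t := by
  obtain ⟨u, hu, h⟩ := hs
  refine h.trans ?_
  replace hm := hm.of_coreEquiv h (.refl t)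
  clear h
  induction hu generalizing t with
  | one => exact coreEquiv_of_mem_core (one_mem _) (hasDeg_zero_iff.1 ht)
  | @cons i D s u hs hu ih =>
    obtain ⟨p, q, hpq⟩ := meets_iff.1 hm
    obtain ⟨D', r, h, hr, h'⟩ := ht.split hE hB hs
      (.inl ⟨Meets.of_eq (x := u * p) (by rw [← mul_assoc, hpq]), Multiset.mem_cons_self i D⟩)
    rw [Multiset.cons_inj_right] at h
    subst h
    have hm' := meets_mul_left_iff.1 (hm.of_coreEquiv (.refl _) h')
    exact (coreEquiv_mul_left_iff.2 (ih hr hm')).trans h'.symm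

theorem exists_hasDeg_meets (hE : ComponentsEdgeFree S) (hB : BalancedFactorization S)
    (hF : NoncoreFactorable S) (hfin : ∀ i : CoComponent (coreGraph S), componentSize i ≠ ⊤)
    (D : Multiset (CoComponent (coreGraph S))) (s : S) : ∃ t, HasDeg D t ∧ Meets s t := by
  induction D using Multiset.induction generalizing s with
  | empty => exact ⟨1, DegWord.one.hasDeg, (meets_one_left s).symm⟩
  | cons i D ih =>
    obtain ⟨t, ht, hm⟩ := exists_inComp_meets hE hB hF hfin i s
    obtain ⟨x, y, hxy⟩ := meets_iff.1 hm
    obtain ⟨r, hr, hm'⟩ := ih x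
    obtain ⟨z, w, hzw⟩ := meets_iff.1 hm'
    exact ⟨t * r, .cons ht hr, Meets.of_eq (x := y * z) (y := w)
      (by rw [← mul_assoc, ← hxy, mul_assoc, hzw, mul_assoc])⟩

/-- Left multiplication on the set of core equivalence classes. -/
def lmul (s : S) : CoreQuotient S → CoreQuotient S :=
  Quotient.map (fun t => s * t) (fun _ _ h => coreEquiv_mul_left_iff.2 h)

theorem encard_hasDeg (hE : ComponentsEdgeFree S) (hB : BalancedFactorization S)
    (hF : NoncoreFactorable S) {m : CoComponent (coreGraph S) → ℕ+}
    (hm : ∀ i, componentSize i = ((m i : ℕ) : ℕ∞)) (D : Multiset (CoComponent (coreGraph S))) :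
    (coreClass '' {s : S | HasDeg D s}).encard = (((D.map m).prod : ℕ+) : ℕ) := by
  have hfin : ∀ i : CoComponent (coreGraph S), componentSize i ≠ ⊤ := fun i => by
    rw [hm]
    exact ENat.natCast_ne_top _
  have hA := hB.actionPreservesComponents
  induction D using Multiset.induction with
  | empty =>
    have : coreClass '' {s : S | HasDeg 0 s} = {coreClass 1} := by
      refine Set.eq_singleton_iff_unique_mem.2 ⟨⟨1, DegWord.one.hasDeg, rfl⟩, ?_⟩
      rintro _ ⟨s, hs, rfl⟩
      exact coreClass_eq_iff.2 (coreEquiv_of_mem_core (hasDeg_zero_iff.1 hs) (one_mem _))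
    simp [this]
  | cons i D ih =>
    have hout : ∀ c : CoreQuotient S, coreClass c.out = c := Quotient.out_eq
    have hin : ∀ c ∈ componentVertices i, InComp i c.out := fun c hc => by
      rwa [← coreClass_mem_componentVertices, hout]
    -- Multiplying chosen representatives of the classes in component `i` by the classes of
    -- degree `D` hits every class of degree `i ::ₘ D` exactly once.
    have himage : (fun c : CoreQuotient S × CoreQuotient S => lmul c.1.out c.2) ''
        (componentVertices i ×ˢ (coreClass '' {s : S | HasDeg D s})) =
        coreClass '' {s : S | HasDeg (i ::ₘ D) s} := by
      ext x
      constructor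
      · rintro ⟨⟨c, _⟩, ⟨hc, r, hr, rfl⟩, rfl⟩
        exact ⟨c.out * r, .cons (hin c hc) hr, rfl⟩
      · rintro ⟨t, ht, rfl⟩
        obtain ⟨s, r, hs, hr, h⟩ := HasDeg.exists_split hE hB hF hfin ht
        obtain ⟨r', hr', h'⟩ := hr.exists_mul hA (coreClass_eq_iff.1 (hout (coreClass s))).symm
        exact ⟨(coreClass s, coreClass r'),
          ⟨coreClass_mem_componentVertices.2 hs, r', hr', rfl⟩,
          coreClass_eq_iff.2 (h.trans h').symm⟩
    have hinj : Set.InjOn (fun c : CoreQuotient S × CoreQuotient S => lmul c.1.out c.2)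
        (componentVertices i ×ˢ (coreClass '' {s : S | HasDeg D s})) := by
      rintro ⟨c, _⟩ ⟨hc, r, -, rfl⟩ ⟨d, _⟩ ⟨hd, r', -, rfl⟩ h
      have h' := coreClass_eq_iff.1 h
      obtain ⟨p, q, hpq⟩ := meets_iff.1 h'.meets
      have hcd : c = d := by
        rw [← hout c, ← hout d]
        exact coreClass_eq_iff.2 (componentsEdgeFree_iff.1 hE i _ _ (hin c hc) (hin d hd)
          (Meets.of_eq (x := r * p) (y := r' * q) (by rw [← mul_assoc, hpq, mul_assoc])))
      subst hcd
      exact Prod.ext rfl (coreClass_eq_iff.2 (coreEquiv_mul_left_iff.1 h'))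
    rw [← himage, hinj.encard_image, Set.encard_prod, ih, Multiset.map_cons, Multiset.prod_cons]
    have := hm i
    rw [componentSize] at this
    rw [this, PNat.mul_coe, Nat.cast_mul]

/-- The generalized scale is the product of the sizes of the components that occur in the degree. -/
theorem exists_isGeneralizedScale (hE : ComponentsEdgeFree S) (hB : BalancedFactorization S)
    (hF : NoncoreFactorable S) (hfree : FreelyGeneratesNontrivial (componentSize (S := S))) :
    ∃ N : S →* ℕ+, IsGeneralizedScale N := by
  obtain ⟨m, hm, hinj, hbot⟩ := hfree
  rw [injective_finsuppProd_iff] at hinj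
  have hfin : ∀ i : CoComponent (coreGraph S), componentSize i ≠ ⊤ := fun i => by
    rw [hm]
    exact ENat.natCast_ne_top _
  choose deg hdeg using exists_hasDeg hF
  have hdeg' : ∀ {s D}, HasDeg D s → deg s = D := fun h => (hdeg _).unique hE hB h
  let N : S →* ℕ+ :=
    { toFun := fun s => ((deg s).map m).prod
      map_one' := by
        rw [hdeg' DegWord.one.hasDeg]
        simp
      map_mul' := fun s t => by
        rw [hdeg' ((hdeg s).mul hB.actionPreservesComponents (hdeg t)), Multiset.map_add,
          Multiset.prod_add] }
  have hN : ∀ s, N s = ((deg s).map m).prod := fun _ => rfl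
  have hND : ∀ s D, N s = (D.map m).prod ↔ HasDeg D s := fun s D =>
    ⟨fun h => hinj (a₂ := D) h ▸ hdeg s, fun h => by rw [hN, hdeg' h]⟩
  refine ⟨N, ⟨fun h1 => hbot ?_, ?_, fun s t hst => ?_, ?_⟩⟩
  · rw [eq_bot_iff, Submonoid.closure_le]
    rintro _ ⟨i, rfl⟩
    obtain ⟨s, hs⟩ := coIndex_surjective i
    have h : HasDeg {i} s := by
      simpa using HasDeg.cons hs DegWord.one.hasDeg
    have := (hND s {i}).2 h
    rw [h1] at this
    simpa using this.symm
  · rintro _ ⟨s, rfl⟩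
    have : {t : S | N t = N s} = {t | HasDeg (deg s) t} := by
      ext t
      exact hND t (deg s)
    rw [this, encard_hasDeg hE hB hF hm]
    rfl
  · by_cases hmt : Meets s t
    · exact .inl ((hdeg s).coreEquiv_of_meets hE hB ((hND t _).1 hst.symm) hmt)
    · exact .inr hmt
  · rintro s _ ⟨r, rfl⟩
    obtain ⟨t, ht, hst⟩ := exists_hasDeg_meets hE hB hF hfin (deg r) s
    exact ⟨t, (hND t _).2 ht, hst⟩

theorem exists_isGeneralizedScale_iff : (∃ N : S →* ℕ+, IsGeneralizedScale N) ↔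
    ComponentsEdgeFree S ∧ NoncoreFactorable S ∧ BalancedFactorization S ∧
      FreelyGeneratesNontrivial (componentSize (S := S)) :=
  ⟨fun ⟨_, hN⟩ => ⟨hN.componentsEdgeFree, hN.noncoreFactorable, hN.balancedFactorization,
    hN.freelyGeneratesNontrivial⟩,
    fun ⟨h₁, h₂, h₃, h₄⟩ => exists_isGeneralizedScale h₁ h₃ h₂ h₄⟩

end Degree

/-! ### Traces: words in the vertex monoids up to commutation -/

section Traces

variable {W : Type*} (Λ : SimpleGraph W) (S : W → Type*)

/-- Two words in the disjoint union of the sets `S w` are shuffles of each other if one is obtained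
from the other by repeatedly swapping neighbouring letters at adjacent vertices. -/
inductive Shuffle : List (Σ w, S w) → List (Σ w, S w) → Prop
  | nil : Shuffle [] []
  | cons (a : Σ w, S w) {l m : List (Σ w, S w)} : Shuffle l m → Shuffle (a :: l) (a :: m)
  | swap (a b : Σ w, S w) (l : List (Σ w, S w)) :
      Λ.Adj a.1 b.1 → Shuffle (b :: a :: l) (a :: b :: l)
  | trans {l m n : List (Σ w, S w)} : Shuffle l m → Shuffle m n → Shuffle l n

/-- `Extract Λ S w s l l'`: the word `l` contains a letter `s` at `w`, preceded only by letters at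
vertices adjacent to `w`, and `l'` is what remains after deleting that letter. -/
inductive Extract (w : W) (s : S w) : List (Σ w, S w) → List (Σ w, S w) → Prop
  | head (l : List (Σ w, S w)) : Extract w s (⟨w, s⟩ :: l) l
  | cons (a : Σ w, S w) {l l' : List (Σ w, S w)} :
      Λ.Adj a.1 w → Extract w s l l' → Extract w s (a :: l) (a :: l')

variable {Λ S}

theorem Shuffle.refl (l : List (Σ w, S w)) : Shuffle Λ S l l := by
  induction l with
  | nil => exact .nil
  | cons a l ih => exact .cons a ih

theorem Shuffle.symm {l m : List (Σ w, S w)} (h : Shuffle Λ S l m) : Shuffle Λ S m l := by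
  induction h with
  | nil => exact .nil
  | cons a _ ih => exact .cons a ih
  | swap a b l h => exact .swap b a l h.symm
  | trans _ _ ih₁ ih₂ => exact .trans ih₂ ih₁

theorem Shuffle.length_eq {l m : List (Σ w, S w)} (h : Shuffle Λ S l m) :
    l.length = m.length := by
  induction h with
  | nil => rfl
  | cons a _ ih => simp [ih]
  | swap a b l h => rfl
  | trans _ _ ih₁ ih₂ => exact ih₁.trans ih₂

theorem Extract.shuffle {w : W} {s : S w} {l l' : List (Σ w, S w)} (h : Extract Λ S w s l l') :
    Shuffle Λ S l (⟨w, s⟩ :: l') := by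
  induction h with
  | head l => exact .refl _
  | cons a ha _ ih => exact (ih.cons a).trans (.swap _ _ _ ha.symm)

theorem Extract.of_shuffle {l m : List (Σ w, S w)} (h : Shuffle Λ S l m) :
    ∀ {w : W} {s : S w} {l' : List (Σ w, S w)}, Extract Λ S w s l l' →
      ∃ m', Extract Λ S w s m m' ∧ Shuffle Λ S l' m' := by
  induction h with
  | nil => intro w s l' h; cases h
  | cons a h ih =>
    intro w s l' he
    cases he with
    | head => exact ⟨_, .head _, h⟩
    | cons _ ha he =>
      obtain ⟨m', h₁, h₂⟩ := ih he
      exact ⟨a :: m', .cons a ha h₁, .cons a h₂⟩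
  | swap a b l h =>
    intro w s l' he
    cases he with
    | head => exact ⟨_, .cons a h (.head _), .refl _⟩
    | cons _ ha he =>
      cases he with
      | head => exact ⟨_, .head _, .refl _⟩
      | cons _ hb he => exact ⟨_, .cons a hb (.cons b ha he), .swap a b _ h⟩
  | trans _ _ ih₁ ih₂ =>
    intro w s l' he
    obtain ⟨m', h₁, h₂⟩ := ih₁ he
    obtain ⟨n', h₃, h₄⟩ := ih₂ h₁
    exact ⟨n', h₃, h₂.trans h₄⟩

variable (Λ S)

/-- Words up to shuffling. -/
def shuffleSetoid : Setoid (List (Σ w, S w)) :=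
  ⟨Shuffle Λ S, Shuffle.refl, Shuffle.symm, Shuffle.trans⟩

/-- A trace: a word in the disjoint union of the `S w` up to shuffling.  No use is made of the
multiplication of the `S w`. -/
def Trace : Type _ := Quotient (shuffleSetoid Λ S)

namespace Trace

/-- The empty trace. -/
def nil : Trace Λ S := Quotient.mk (shuffleSetoid Λ S) []

variable {Λ S}

/-- The trace with a further letter put in front. -/
def cons (w : W) (s : S w) : Trace Λ S → Trace Λ S :=
  Quotient.map (fun l => ⟨w, s⟩ :: l) (fun _ _ h => Shuffle.cons _ h)

/-- The number of letters of a trace. -/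
def length : Trace Λ S → ℕ := Quotient.lift List.length (fun _ _ h => Shuffle.length_eq h)

@[simp] theorem length_nil : (nil Λ S).length = 0 := rfl

@[simp] theorem length_cons (w : W) (s : S w) (x : Trace Λ S) :
    (cons w s x).length = x.length + 1 := by
  induction x using Quotient.ind
  rfl

theorem nil_ne_cons (w : W) (s : S w) (x : Trace Λ S) : nil Λ S ≠ cons w s x :=
  fun h => by simpa using congrArg length h

theorem cons_comm {v w : W} (h : Λ.Adj v w) (s : S v) (t : S w) (x : Trace Λ S) :
    cons v s (cons w t x) = cons w t (cons v s x) := by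
  induction x using Quotient.ind
  exact Quotient.sound (Shuffle.swap _ _ _ h.symm)

theorem cons_injective {w : W} {s t : S w} {x y : Trace Λ S} (h : cons w s x = cons w t y) :
    s = t ∧ x = y := by
  induction x using Quotient.ind
  induction y using Quotient.ind
  obtain ⟨m', h₁, h₂⟩ := Extract.of_shuffle (Quotient.exact h) (.head _)
  cases h₁ with
  | head => exact ⟨rfl, Quotient.sound h₂⟩
  | cons _ ha _ => exact absurd ha Λ.irrefl

theorem cons_eq_cons {v w : W} (hvw : v ≠ w) {s : S v} {t : S w} {x y : Trace Λ S}
    (h : cons v s x = cons w t y) :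
    Λ.Adj v w ∧ ∃ z, x = cons w t z ∧ y = cons v s z := by
  induction x using Quotient.ind
  induction y using Quotient.ind
  obtain ⟨m', h₁, h₂⟩ := Extract.of_shuffle (Quotient.exact h) (.head _)
  cases h₁ with
  | head => exact absurd rfl hvw
  | @cons _ _ l' ha h₁ =>
    exact ⟨ha.symm, Quotient.mk _ l', Quotient.sound h₂, Quotient.sound h₁.shuffle⟩

/-- No letter at `w` can be moved to the front of the trace. -/
def NoHead (w : W) (x : Trace Λ S) : Prop := ∀ s y, x ≠ cons w s y

theorem NoHead.cons {v w : W} (hvw : v ≠ w) {s : S v} {x : Trace Λ S} (h : NoHead w x) :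
    NoHead w (cons v s x) := by
  intro t y hy
  obtain ⟨-, z, rfl, -⟩ := cons_eq_cons hvw hy
  exact h _ _ rfl

theorem NoHead.of_cons {v w : W} (hvw : Λ.Adj v w) {s : S v} {x : Trace Λ S}
    (h : NoHead w (Trace.cons v s x)) : NoHead w x := by
  rintro t y rfl
  exact h _ _ (cons_comm hvw _ _ _)

variable [∀ w, Monoid (S w)]

/-- Reduced traces: no letter is `1`, and no two letters at the same vertex can be made
neighbours by shuffling. -/
inductive Reduced : Trace Λ S → Prop
  | nil : Reduced (nil Λ S)
  | cons {w : W} {s : S w} {x : Trace Λ S} :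
      s ≠ 1 → NoHead w x → Reduced x → Reduced (cons w s x)

theorem Reduced.of_cons {w : W} {s : S w} {x : Trace Λ S} (h : Reduced (Trace.cons w s x)) :
    s ≠ 1 ∧ NoHead w x ∧ Reduced x := by
  generalize hy : Trace.cons w s x = y at h
  induction h generalizing w s x with
  | nil => exact absurd hy.symm (nil_ne_cons _ _ _)
  | @cons v t z ht hz hr ih =>
    by_cases hvw : v = w
    · subst hvw
      obtain ⟨rfl, rfl⟩ := cons_injective hy
      exact ⟨ht, hz, hr⟩
    · obtain ⟨hadj, u, rfl, rfl⟩ := cons_eq_cons (Ne.symm hvw) hy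
      obtain ⟨h₁, h₂, h₃⟩ := ih rfl
      exact ⟨h₁, h₂.cons hvw, .cons ht (hz.of_cons hadj) h₃⟩

open Classical in
/-- Put the letter `s` at `w` in front, unless `s = 1`. -/
noncomputable def consOne (w : W) (s : S w) (x : Trace Λ S) : Trace Λ S :=
  if s = 1 then x else cons w s x

theorem consOne_one (w : W) (x : Trace Λ S) : consOne w 1 x = x := if_pos rfl

theorem consOne_of_ne {w : W} {s : S w} (hs : s ≠ 1) (x : Trace Λ S) :
    consOne w s x = cons w s x := if_neg hs

theorem consOne_comm {v w : W} (h : Λ.Adj v w) (s : S v) (t : S w) (x : Trace Λ S) :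
    consOne v s (consOne w t x) = consOne w t (consOne v s x) := by
  by_cases hs : s = 1 <;> by_cases ht : t = 1 <;>
    simp [consOne, hs, ht, cons_comm h]

theorem Reduced.consOne {w : W} {s : S w} {x : Trace Λ S} (hx : Reduced x) (h : NoHead w x) :
    Reduced (consOne w s x) := by
  by_cases hs : s = 1
  · rwa [hs, consOne_one]
  · rw [consOne_of_ne hs]
    exact .cons hs h hx

theorem NoHead.consOne {v w : W} (hvw : v ≠ w) {s : S v} {x : Trace Λ S} (h : NoHead w x) :
    NoHead w (consOne v s x) := by
  by_cases hs : s = 1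
  · rwa [hs, consOne_one]
  · rw [consOne_of_ne hs]
    exact h.cons hvw

theorem NoHead.of_consOne {v w : W} (hvw : Λ.Adj v w) {s : S v} {x : Trace Λ S}
    (h : NoHead w (Trace.consOne v s x)) : NoHead w x := by
  by_cases hs : s = 1
  · rwa [hs, consOne_one] at h
  · rw [consOne_of_ne hs] at h
    exact h.of_cons hvw

theorem length_consOne_le (w : W) (s : S w) (x : Trace Λ S) :
    (consOne w s x).length ≤ x.length + 1 := by
  by_cases hs : s = 1
  · simp [hs, consOne_one]
  · simp [consOne_of_ne hs]

theorem length_le_consOne (w : W) (s : S w) (x : Trace Λ S) :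
    x.length ≤ (consOne w s x).length := by
  by_cases hs : s = 1
  · simp [hs, consOne_one]
  · simp [consOne_of_ne hs]

theorem consOne_injective {w : W} {s t : S w} {x y : Trace Λ S} (hx : NoHead w x)
    (hy : NoHead w y) (h : consOne w s x = consOne w t y) : s = t ∧ x = y := by
  by_cases hs : s = 1 <;> by_cases ht : t = 1
  · simpa [hs, ht, consOne_one] using h
  · rw [hs, consOne_one, consOne_of_ne ht] at h
    exact absurd h (hx _ _)
  · rw [ht, consOne_one, consOne_of_ne hs] at h
    exact absurd h.symm (hy _ _)
  · rw [consOne_of_ne hs, consOne_of_ne ht] at h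
    exact cons_injective h

theorem Reduced.exists_consOne {x : Trace Λ S} (hx : Reduced x) (w : W) :
    ∃ (s : S w) (y : Trace Λ S), x = Trace.consOne w s y ∧ NoHead w y ∧ Reduced y := by
  by_cases h : NoHead w x
  · exact ⟨1, x, (consOne_one _ _).symm, h, hx⟩
  · unfold NoHead at h
    push Not at h
    obtain ⟨s, y, rfl⟩ := h
    obtain ⟨h₁, h₂, h₃⟩ := hx.of_cons
    exact ⟨s, y, (consOne_of_ne h₁ _).symm, h₂, h₃⟩

end Trace

variable [∀ w, Monoid (S w)]

/-- The type of reduced traces, on which the graph product acts. -/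
abbrev RedTrace : Type _ := {x : Trace Λ S // x.Reduced}

namespace RedTrace

variable {Λ S}

/-- The letter at `w` that can be moved to the front of a reduced trace, or `1`. -/
noncomputable def hd (w : W) (x : RedTrace Λ S) : S w := (x.2.exists_consOne w).choose

/-- What remains of a reduced trace after removing the letter `hd w x` from its front. -/
noncomputable def tl (w : W) (x : RedTrace Λ S) : RedTrace Λ S :=
  ⟨(x.2.exists_consOne w).choose_spec.choose, (x.2.exists_consOne w).choose_spec.choose_spec.2.2⟩

theorem noHead_tl (w : W) (x : RedTrace Λ S) : (x.tl w).1.NoHead w :=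
  (x.2.exists_consOne w).choose_spec.choose_spec.2.1

theorem consOne_hd_tl (w : W) (x : RedTrace Λ S) : Trace.consOne w (x.hd w) (x.tl w).1 = x.1 :=
  (x.2.exists_consOne w).choose_spec.choose_spec.1.symm

theorem hd_tl_unique {w : W} {x : RedTrace Λ S} {s : S w} {y : Trace Λ S}
    (h : x.1 = Trace.consOne w s y) (hy : y.NoHead w) : x.hd w = s ∧ (x.tl w).1 = y :=
  Trace.consOne_injective (noHead_tl w x) hy ((consOne_hd_tl w x).trans h)

/-- The action of `s : S w` on a reduced trace multiplies the letter at `w` in its front by `s`. -/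
noncomputable def act (w : W) (s : S w) (x : RedTrace Λ S) : RedTrace Λ S :=
  ⟨Trace.consOne w (s * x.hd w) (x.tl w).1, (x.tl w).2.consOne (noHead_tl w x)⟩

theorem coe_act (w : W) (s : S w) (x : RedTrace Λ S) :
    (act w s x).1 = Trace.consOne w (s * x.hd w) (x.tl w).1 := rfl

theorem hd_act_self (w : W) (s : S w) (x : RedTrace Λ S) : (act w s x).hd w = s * x.hd w :=
  (hd_tl_unique rfl (noHead_tl w x)).1

theorem tl_act_self (w : W) (s : S w) (x : RedTrace Λ S) : (act w s x).tl w = x.tl w :=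
  Subtype.ext (hd_tl_unique rfl (noHead_tl w x)).2

theorem act_one (w : W) (x : RedTrace Λ S) : act w 1 x = x :=
  Subtype.ext (by simp only [act, one_mul, consOne_hd_tl])

theorem act_mul (w : W) (s t : S w) (x : RedTrace Λ S) :
    act w (s * t) x = act w s (act w t x) :=
  Subtype.ext (by
    change Trace.consOne _ _ _ = Trace.consOne _ _ _
    rw [hd_act_self, tl_act_self, mul_assoc])

/-- Two commuting letters can be split off from a reduced trace simultaneously. -/
theorem exists_consOne_consOne {v w : W} (h : Λ.Adj v w) (x : RedTrace Λ S) :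
    ∃ z : Trace Λ S, z.NoHead v ∧ z.NoHead w ∧
      (∀ s, (act v s x).1 = Trace.consOne v (s * x.hd v) (Trace.consOne w (x.hd w) z)) ∧
      ∀ t, (act w t x).1 = Trace.consOne w (t * x.hd w) (Trace.consOne v (x.hd v) z) := by
  have hz := (x.tl w).consOne_hd_tl v
  set z := ((x.tl w).tl v).1
  have hv : z.NoHead v := noHead_tl _ _
  have hw : z.NoHead w :=
    (hz.symm ▸ noHead_tl w x : Trace.NoHead w (Trace.consOne v _ z)).of_consOne h
  have hx : x.1 = Trace.consOne v ((x.tl w).hd v) (Trace.consOne w (x.hd w) z) := by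
    rw [Trace.consOne_comm h, hz, consOne_hd_tl]
  obtain ⟨h₁, h₂⟩ := hd_tl_unique hx (hv.consOne h.ne.symm)
  refine ⟨z, hv, hw, fun s => ?_, fun t => ?_⟩
  · rw [coe_act, h₂]
  · rw [coe_act, h₁, hz]

theorem act_comm {v w : W} (h : Λ.Adj v w) (s : S v) (t : S w) (x : RedTrace Λ S) :
    act v s (act w t x) = act w t (act v s x) := by
  obtain ⟨z, hv, hw, h₁, h₂⟩ := exists_consOne_consOne h x
  have e₁ := hd_tl_unique ((h₂ t).trans (Trace.consOne_comm h _ _ _).symm) (hv.consOne h.ne.symm)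
  have e₂ := hd_tl_unique ((h₁ s).trans (Trace.consOne_comm h _ _ _)) (hw.consOne h.ne)
  refine Subtype.ext ?_
  change Trace.consOne _ _ _ = Trace.consOne _ _ _
  rw [e₁.1, e₁.2, e₂.1, e₂.2, Trace.consOne_comm h]

theorem hd_act_of_adj {v w : W} (h : Λ.Adj v w) (s : S v) (x : RedTrace Λ S) :
    (act v s x).hd w = x.hd w := by
  obtain ⟨z, hv, hw, h₁, -⟩ := exists_consOne_consOne h x
  exact (hd_tl_unique ((h₁ s).trans (Trace.consOne_comm h _ _ _)) (hw.consOne h.ne)).1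

theorem hd_eq_one {v w : W} (hvw : v ≠ w) (h : ¬ Λ.Adj v w) (x : RedTrace Λ S)
    (hv : x.hd v ≠ 1) : x.hd w = 1 := by
  by_contra hw
  have e := (consOne_hd_tl v x).trans (consOne_hd_tl w x).symm
  rw [Trace.consOne_of_ne hv, Trace.consOne_of_ne hw] at e
  exact h (Trace.cons_eq_cons hvw e).1

theorem length_act_le (w : W) (s : S w) (x : RedTrace Λ S) :
    (act w s x).1.length ≤ x.1.length + 1 := by
  refine (Trace.length_consOne_le _ _ _).trans ?_
  conv_rhs => rw [← consOne_hd_tl w x]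
  exact Nat.add_le_add_right (Trace.length_le_consOne _ _ _) 1

end RedTrace

end Traces

/-! ### Normal forms in graph products -/

section NormalForm

variable {W : Type*} (Λ : SimpleGraph W) (S : W → Type*) [∀ w, Monoid (S w)]

namespace GraphProduct

theorem of_comm {v w : W} (h : Λ.Adj v w) (s : S v) (t : S w) :
    of Λ S v s * of Λ S w t = of Λ S w t * of Λ S v s :=
  (Con.eq (graphCon Λ S)).2 (ConGen.Rel.of _ _ ⟨v, w, h, s, t, rfl, rfl⟩)

variable {Λ S}

/-- The universal property of the graph product. -/
def lift {M : Type*} [Monoid M] (f : ∀ w, S w →* M)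
    (hf : ∀ v w, Λ.Adj v w → ∀ s t, f v s * f w t = f w t * f v s) : GraphProduct Λ S →* M :=
  (graphCon Λ S).lift (Monoid.CoprodI.lift f) (Con.conGen_le.2 (by
    rintro _ _ ⟨v, w, h, s, t, rfl, rfl⟩
    simpa [Con.ker_rel] using hf v w h s t))

@[simp] theorem lift_of {M : Type*} [Monoid M] (f : ∀ w, S w →* M)
    (hf : ∀ v w, Λ.Adj v w → ∀ s t, f v s * f w t = f w t * f v s) (w : W) (s : S w) :
    lift f hf (of Λ S w s) = f w s :=
  Monoid.CoprodI.lift_of f s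

theorem induction_left {p : GraphProduct Λ S → Prop} (x : GraphProduct Λ S) (one : p 1)
    (mul : ∀ w (s : S w) x, p x → p (of Λ S w s * x)) : p x := by
  induction x using Con.induction_on with
  | H x =>
    induction x using Monoid.CoprodI.induction_left with
    | one => exact one
    | mul s x ih => exact mul _ s _ ih

/-- The action of the graph product on reduced traces. -/
noncomputable def toEnd : GraphProduct Λ S →* Function.End (RedTrace Λ S) :=
  lift (fun w =>
    { toFun := fun s => RedTrace.act w s
      map_one' := funext (RedTrace.act_one w)
      map_mul' := fun s t => funext (RedTrace.act_mul w s t) })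
    (fun _ _ h s t => funext (RedTrace.act_comm h s t))

/-- The normal form of an element of the graph product. -/
noncomputable def normalForm (p : GraphProduct Λ S) : RedTrace Λ S := toEnd p ⟨Trace.nil Λ S, .nil⟩

theorem normalForm_of_mul (w : W) (s : S w) (p : GraphProduct Λ S) :
    normalForm (of Λ S w s * p) = RedTrace.act w s (normalForm p) := by
  have : toEnd (of Λ S w s) = RedTrace.act w s := lift_of _ _ w s
  unfold normalForm
  rw [map_mul, this]
  rfl

/-- The product of the letters of a trace. -/
def traceProd : Trace Λ S → GraphProduct Λ S :=
  Quotient.lift (fun l => (l.map fun a => of Λ S a.1 a.2).prod) (by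
    intro l m h
    induction h with
    | nil => rfl
    | cons a _ ih => simpa using congrArg (of Λ S a.1 a.2 * ·) ih
    | swap a b l h => simp only [List.map_cons, List.prod_cons, ← mul_assoc, of_comm Λ S h]
    | trans _ _ ih₁ ih₂ => exact ih₁.trans ih₂)

theorem traceProd_cons (w : W) (s : S w) (x : Trace Λ S) :
    traceProd (Trace.cons w s x) = of Λ S w s * traceProd x := by
  induction x using Quotient.ind
  exact List.prod_cons

theorem traceProd_consOne (w : W) (s : S w) (x : Trace Λ S) :
    traceProd (Trace.consOne w s x) = of Λ S w s * traceProd x := by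
  by_cases hs : s = 1
  · rw [hs, Trace.consOne_one, map_one, one_mul]
  · rw [Trace.consOne_of_ne hs, traceProd_cons]

theorem traceProd_normalForm (p : GraphProduct Λ S) : traceProd (normalForm p).1 = p := by
  induction p using induction_left with
  | one => exact List.prod_nil
  | mul w s p ih =>
    rw [normalForm_of_mul]
    conv_rhs => rw [← ih, ← RedTrace.consOne_hd_tl w (normalForm p)]
    rw [traceProd_consOne, ← mul_assoc, ← map_mul]
    exact traceProd_consOne _ _ _

theorem normalForm_traceProd (x : RedTrace Λ S) : normalForm (traceProd x.1) = x := by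
  obtain ⟨x, hx⟩ := x
  induction hx with
  | nil =>
    have : traceProd (Trace.nil Λ S) = 1 := List.prod_nil
    simp only [this, normalForm, map_one]
    rfl
  | @cons w s y hs hw hy ih =>
    refine Subtype.ext ?_
    simp only at ih ⊢
    rw [traceProd_cons, normalForm_of_mul, ih]
    obtain ⟨h₁, h₂⟩ := RedTrace.hd_tl_unique (x := ⟨y, hy⟩) (Trace.consOne_one w y).symm hw
    rw [RedTrace.coe_act, h₁, h₂, mul_one, Trace.consOne_of_ne hs]

/-- The `w`-head of `p`: the factor from `S w` that can be split off on the left of `p`. -/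
noncomputable def head (w : W) (p : GraphProduct Λ S) : S w := (normalForm p).hd w

/-- The complementary factor to the `w`-head. -/
noncomputable def tail (w : W) (p : GraphProduct Λ S) : GraphProduct Λ S :=
  traceProd ((normalForm p).tl w).1

/-- The syllable length. -/
noncomputable def len (p : GraphProduct Λ S) : ℕ := (normalForm p).1.length

theorem of_head_mul_tail (w : W) (p : GraphProduct Λ S) :
    of Λ S w (head w p) * tail w p = p := by
  rw [head, tail, ← traceProd_consOne, RedTrace.consOne_hd_tl, traceProd_normalForm]

theorem head_of_mul (w : W) (s : S w) (p : GraphProduct Λ S) :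
    head w (of Λ S w s * p) = s * head w p := by
  rw [head, normalForm_of_mul, RedTrace.hd_act_self, head]

theorem tail_of_mul (w : W) (s : S w) (p : GraphProduct Λ S) :
    tail w (of Λ S w s * p) = tail w p := by
  rw [tail, normalForm_of_mul, RedTrace.tl_act_self, tail]

theorem head_of_mul_of_adj {v w : W} (h : Λ.Adj v w) (s : S v) (p : GraphProduct Λ S) :
    head w (of Λ S v s * p) = head w p := by
  rw [head, normalForm_of_mul, RedTrace.hd_act_of_adj h, head]

theorem head_eq_one {v w : W} (hvw : v ≠ w) (h : ¬ Λ.Adj v w) {p : GraphProduct Λ S}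
    (hv : head v p ≠ 1) : head w p = 1 :=
  RedTrace.hd_eq_one hvw h _ hv

theorem len_of_mul_le (w : W) (s : S w) (p : GraphProduct Λ S) :
    len (of Λ S w s * p) ≤ len p + 1 := by
  rw [len, normalForm_of_mul]
  exact RedTrace.length_act_le w s _

/-- The first letter of a normal form can be split off. -/
theorem eq_one_or_exists_of_mul (p : GraphProduct Λ S) : p = 1 ∨ ∃ (v : W) (t : S v)
    (q : GraphProduct Λ S), p = of Λ S v t * q ∧ t ≠ 1 ∧ head v q = 1 ∧ len p = len q + 1 := by
  have hp := traceProd_normalForm p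
  obtain ⟨x, hx⟩ : ∃ x, normalForm p = x := ⟨_, rfl⟩
  rw [hx] at hp
  obtain ⟨x, hr⟩ := x
  cases hr with
  | nil => exact .inl (hp.symm.trans List.prod_nil)
  | @cons w s y hs hw hy =>
    simp only at hp
    have hq := normalForm_traceProd ⟨y, hy⟩
    refine .inr ⟨w, s, traceProd y, by rw [← hp, traceProd_cons], hs, ?_, ?_⟩
    · rw [head, hq]
      exact (RedTrace.hd_tl_unique (Trace.consOne_one w y).symm hw).1
    · rw [len, len, hq, hx, Trace.length_cons]

/-! ### Graph products of right LCM monoids are right LCM -/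

variable [∀ w, IsRightLCM (S w)]

theorem of_mul_left_cancel {w : W} {s : S w} {p q : GraphProduct Λ S}
    (h : of Λ S w s * p = of Λ S w s * q) : p = q := by
  have h₁ := congrArg (head w) h
  have h₂ := congrArg (tail w) h
  rw [head_of_mul, head_of_mul] at h₁
  rw [tail_of_mul, tail_of_mul] at h₂
  rw [← of_head_mul_tail w p, ← of_head_mul_tail w q, mul_left_cancel h₁, h₂]

instance : IsLeftCancelMul (GraphProduct Λ S) where
  mul_left_cancel p q r h := by
    induction p using induction_left with
    | one => simpa using h
    | mul w s p ih =>
      simp only [mul_assoc] at h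
      exact ih (of_mul_left_cancel h)

/-- Left multiplication by `a` does not affect anything at the vertex `w`. -/
def Transparent (w : W) (a : GraphProduct Λ S) : Prop :=
  (∀ x, head w (a * x) = head w x) ∧ ∀ s, of Λ S w s * a = a * of Λ S w s

/-- Either the `w`-head of `p * x` does not depend on `x`, or, up to a unit on the right, `p` is the
product of an element of `S w` and an element that is transparent for `w`.  The second case of the
induction step is where a letter of `p` that separates `x` from the front may be cancelled by `x`:
then this letter is a unit, and it can be moved to the end of `p`. -/
theorem head_mul_dichotomy (p : GraphProduct Λ S) (w : W) :
    (∃ (h : S w) (a : GraphProduct Λ S) (b : (GraphProduct Λ S)ˣ), Transparent w a ∧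
      len a ≤ len p ∧ p = of Λ S w h * a * b) ∨ ∀ x, head w (p * x) = head w p := by
  induction hn : len p using Nat.strong_induction_on generalizing p w with
  | _ n ih =>
    subst hn
    obtain rfl | ⟨v, t, q, rfl, ht, hq, hlen⟩ := eq_one_or_exists_of_mul p
    · exact .inl ⟨1, 1, 1, ⟨fun x => by rw [one_mul], fun s => by simp⟩, le_rfl, by simp⟩
    have hlt : len q < len (of Λ S v t * q) := by omega
    by_cases hvw : v = w
    · subst hvw
      obtain ⟨h, a, b, ha, hl, e⟩ | hb := ih _ hlt q v rfl
      · refine .inl ⟨t * h, a, b, ha, by omega, ?_⟩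
        rw [map_mul]
        conv_lhs => rw [e]
        simp only [mul_assoc]
      · exact .inr fun x => by rw [mul_assoc, head_of_mul, head_of_mul, hb]
    by_cases hadj : Λ.Adj v w
    · obtain ⟨h, a, b, ha, hl, e⟩ | hb := ih _ hlt q w rfl
      · refine .inl ⟨h, of Λ S v t * a, b, ⟨fun x => ?_, fun s => ?_⟩, ?_, ?_⟩
        · rw [mul_assoc, head_of_mul_of_adj hadj, ha.1]
        · rw [← mul_assoc, ← of_comm Λ S hadj, mul_assoc, ha.2, mul_assoc]
        · exact (len_of_mul_le _ _ _).trans (by omega)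
        · conv_lhs => rw [e]
          rw [← mul_assoc, ← mul_assoc, ← mul_assoc, of_comm Λ S hadj]
      · exact .inr fun x => by rw [mul_assoc, head_of_mul_of_adj hadj, head_of_mul_of_adj hadj, hb]
    -- It suffices that the `v`-head of `p * x` is never trivial.
    have block : (∀ x, head v (of Λ S v t * q * x) ≠ 1) →
        ∀ x, head w (of Λ S v t * q * x) = head w (of Λ S v t * q) := fun h x => by
      have h₁ := h 1
      rw [mul_one] at h₁
      rw [head_eq_one hvw hadj (h x), head_eq_one hvw hadj h₁]
    obtain ⟨h, a, b, ha, hl, e⟩ | hb := ih _ hlt q v rfl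
    · by_cases hu : IsUnit (t * h)
      · obtain ⟨u, hu⟩ := hu.map (of Λ S v)
        have e' : of Λ S v t * q = a * (u * b : (GraphProduct Λ S)ˣ) := by
          conv_lhs => rw [e]
          rw [Units.val_mul, hu, ← mul_assoc, ← mul_assoc, ← mul_assoc, ← map_mul, ha.2]
        obtain ⟨h', a', b', ha', hl', e''⟩ | hb := ih (len a) (by omega) a w rfl
        · refine .inl ⟨h', a', b' * (u * b), ha', by omega, ?_⟩
          rw [e']
          conv_lhs => rw [e'']
          simp only [Units.val_mul, mul_assoc]
        · exact .inr fun x => by rw [e', mul_assoc, hb, hb]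
      · refine .inr (block fun x hx => hu ?_)
        have hx' : t * h * head v (b.val * x) = 1 := by
          rw [e] at hx
          rwa [mul_assoc, mul_assoc, mul_assoc, head_of_mul, head_of_mul, ha.1, ← mul_assoc] at hx
        refine ⟨⟨t * h, head v (b.val * x), hx', mul_left_cancel (a := t * h) ?_⟩, rfl⟩
        rw [← mul_assoc, hx', one_mul, mul_one]
    · refine .inr (block fun x => ?_)
      rwa [mul_assoc, head_of_mul, hb, hq, mul_one]

/-- In the first case of `head_mul_dichotomy` the least common multiple is computed in `S w`; in the
second case `q` is itself a multiple of `s`. -/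
theorem exists_isLcm_of {w : W} {s : S w} {q : GraphProduct Λ S} (hm : Meets (of Λ S w s) q) :
    ∃ x y, IsLcm (of Λ S w s) q x y := by
  obtain ⟨u₀, v₀, h₀⟩ := meets_iff.1 hm
  obtain ⟨h, a, b, ha, -, rfl⟩ | hb := head_mul_dichotomy q w
  · have key : ∀ u v, of Λ S w s * u = of Λ S w h * a * b * v →
        s * head w u = h * head w (b.val * v) := by
      intro u v huv
      have := congrArg (head w) huv
      rwa [mul_assoc, mul_assoc, head_of_mul, head_of_mul, ha.1] at this
    obtain ⟨x, y, hxy⟩ := (Meets.of_eq (key u₀ v₀ h₀)).exists_isLcm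
    have e : of Λ S w s * (of Λ S w x * a) =
        of Λ S w h * a * b * (((b⁻¹ : (GraphProduct Λ S)ˣ) : GraphProduct Λ S) * of Λ S w y) := by
      rw [← mul_assoc, ← map_mul, hxy.1, map_mul, mul_assoc, ha.2,
        mul_assoc _ (b : GraphProduct Λ S), Units.mul_inv_cancel_left, mul_assoc]
    refine ⟨_, _, e, fun u v huv => ?_⟩
    obtain ⟨k, -, hk⟩ := hxy.2 _ _ (key u v huv)
    have hv : v = ((b⁻¹ : (GraphProduct Λ S)ˣ) : GraphProduct Λ S) * of Λ S w y *
        (of Λ S w k * tail w (b.val * v)) := by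
      rw [mul_assoc, ← mul_assoc (of Λ S w y), ← map_mul, ← hk, of_head_mul_tail,
        Units.inv_mul_cancel_left]
    refine ⟨_, ?_, hv⟩
    apply mul_left_cancel (a := of Λ S w s)
    rw [huv, ← mul_assoc (of Λ S w s), e, mul_assoc (_ * _ * _), ← hv]
  · have hq : q = of Λ S w s * (of Λ S w (head w u₀) * tail w q) := by
      rw [← mul_assoc, ← map_mul, ← head_of_mul, h₀, hb, of_head_mul_tail]
    refine ⟨of Λ S w (head w u₀) * tail w q, 1, by rw [mul_one]; exact hq.symm,
      fun u v huv => ⟨v, ?_, (one_mul v).symm⟩⟩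
    apply mul_left_cancel (a := of Λ S w s)
    rw [huv, ← mul_assoc, ← hq]

theorem exists_isLcm {p q : GraphProduct Λ S} (hm : Meets p q) : ∃ x y, IsLcm p q x y := by
  induction p using induction_left generalizing q with
  | one =>
    exact ⟨q, 1, by simp, fun u v h => ⟨v, by rw [← h, one_mul], (one_mul v).symm⟩⟩
  | mul w s p ih =>
    obtain ⟨u, v, huv⟩ := meets_iff.1 hm
    rw [mul_assoc] at huv
    obtain ⟨x, y, hxy⟩ := exists_isLcm_of (Meets.of_eq huv)
    obtain ⟨k, hk, -⟩ := hxy.2 _ _ huv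
    obtain ⟨x', y', h'⟩ := ih (Meets.of_eq hk)
    exact ⟨_, _, (hxy.symm.comp h'.symm).symm⟩

instance : IsRightLCM (GraphProduct Λ S) where
  inter_principal p q := by
    by_cases hm : Meets p q
    · obtain ⟨x, y, h⟩ := exists_isLcm hm
      exact .inr ⟨_, (isLcm_iff.1 h).1⟩
    · exact .inl (Set.not_nonempty_iff_eq_empty.1 hm)

end GraphProduct

end NormalForm

/-! ### Direct sums of monoids -/

/-- The homomorphisms `π j` are the coordinates of an isomorphism of `T` with the direct sum of the
monoids `M j`. -/
structure IsDirectSum {J T : Type*} {M : J → Type*} [Monoid T] [∀ j, Monoid (M j)]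
    (π : ∀ j, T →* M j) : Prop where
  ext : ∀ x y : T, (∀ j, π j x = π j y) → x = y
  finite : ∀ x : T, {j | π j x ≠ 1}.Finite
  surj : ∀ f : ∀ j, M j, {j | f j ≠ 1}.Finite → ∃ x, ∀ j, π j x = f j

/-! ### The decomposition of a graph product along coconnected components -/

section Decomposition

variable {W : Type*} (Λ : SimpleGraph W) (S : W → Type*) [∀ w, Monoid (S w)]

namespace GraphProduct

open Classical in
/-- The projection of the graph product to the factor of a coconnected component. -/
noncomputable def proj (j : CoComponent Λ) : GraphProduct Λ S →* ComponentProduct Λ S j :=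
  lift (fun w => if h : w ∈ j.supp then
      GraphProduct.of (Λ.induce j.supp) (fun w => S w) ⟨w, h⟩ else 1) (by
    intro v w hvw s t
    by_cases hv : v ∈ j.supp
    · by_cases hw : w ∈ j.supp
      · simp only [dif_pos hv, dif_pos hw]
        exact of_comm (Λ.induce j.supp) (fun w : j.supp => S w) (v := ⟨v, hv⟩) (w := ⟨w, hw⟩)
          hvw s t
      · simp only [dif_neg hw, MonoidHom.one_apply, mul_one, one_mul]
    · simp only [dif_neg hv, MonoidHom.one_apply, mul_one, one_mul])

/-- The inclusion of the factor of a coconnected component into the graph product. -/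
def incl (j : CoComponent Λ) : ComponentProduct Λ S j →* GraphProduct Λ S :=
  lift (fun w => of Λ S w) (fun v w (h : Λ.Adj (v : W) w) s t => of_comm Λ S h s t)

theorem proj_of {j : CoComponent Λ} {w : W} (h : w ∈ j.supp) (s : S w) :
    proj Λ S j (of Λ S w s) = of (Λ.induce j.supp) (fun w => S w) ⟨w, h⟩ s := by
  rw [proj, lift_of, dif_pos h]

theorem proj_of_notMem {j : CoComponent Λ} {w : W} (h : w ∉ j.supp) (s : S w) :
    proj Λ S j (of Λ S w s) = 1 := by
  rw [proj, lift_of, dif_neg h, MonoidHom.one_apply]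

theorem incl_of (j : CoComponent Λ) (w : j.supp) (s : S w) :
    incl Λ S j (of (Λ.induce j.supp) (fun w => S w) w s) = of Λ S w s :=
  lift_of (Λ := Λ.induce j.supp) (S := fun w : j.supp => S w) (fun w => of Λ S w) _ w s

theorem proj_incl (j : CoComponent Λ) (x : ComponentProduct Λ S j) :
    proj Λ S j (incl Λ S j x) = x := by
  induction x using induction_left with
  | one => simp
  | mul w s x ih => rw [map_mul, map_mul, ih, incl_of, proj_of Λ S w.2]

theorem proj_incl_of_ne {j k : CoComponent Λ} (h : k ≠ j) (x : ComponentProduct Λ S j) :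
    proj Λ S k (incl Λ S j x) = 1 := by
  induction x using induction_left with
  | one => simp
  | mul w s x ih =>
    rw [map_mul, map_mul, ih, incl_of, proj_of_notMem Λ S, one_mul]
    exact fun hw => h (hw.symm.trans w.2)

theorem adj_of_mem_supp {j k : CoComponent Λ} (h : j ≠ k) {v w : W} (hv : v ∈ j.supp)
    (hw : w ∈ k.supp) : Λ.Adj v w := by
  by_contra hadj
  refine h (hv.symm.trans (Eq.trans ?_ hw))
  by_cases hvw : v = w
  · rw [hvw]
  · exact SimpleGraph.ConnectedComponent.eq.2 (SimpleGraph.Adj.reachable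
      ((SimpleGraph.compl_adj _ _ _).2 ⟨hvw, hadj⟩))

theorem commute_incl {j k : CoComponent Λ} (h : j ≠ k) (x : ComponentProduct Λ S j)
    (y : ComponentProduct Λ S k) : Commute (incl Λ S j x) (incl Λ S k y) := by
  induction x using induction_left with
  | one => simp
  | mul v s x ihx =>
    rw [map_mul, incl_of]
    refine Commute.mul_left ?_ ihx
    clear ihx
    induction y using induction_left with
    | one => simp
    | mul w t y ihy =>
      rw [map_mul, incl_of]
      exact Commute.mul_right (of_comm Λ S (adj_of_mem_supp Λ h v.2 w.2) s t) ihy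

theorem pairwise_commute (U : Finset (CoComponent Λ)) (f : ∀ j, ComponentProduct Λ S j) :
    (U : Set (CoComponent Λ)).Pairwise (Function.onFun Commute fun j => incl Λ S j (f j)) :=
  fun _ _ _ _ h => commute_incl Λ S h _ _

/-- Every element is the product of its components. -/
theorem exists_eq_noncommProd (p : GraphProduct Λ S) :
    ∃ U₀ : Finset (CoComponent Λ), ∀ U, U₀ ⊆ U →
      p = U.noncommProd (fun j => incl Λ S j (proj Λ S j p)) (pairwise_commute Λ S U _) := by
  classical
  induction p using induction_left with
  | one =>
    refine ⟨∅, fun U _ => ?_⟩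
    rw [Finset.noncommProd_eq_pow_card _ _ _ 1 (by simp), one_pow]
  | mul w s p ih =>
    obtain ⟨U₀, ih⟩ := ih
    refine ⟨insert (Λᶜ.connectedComponentMk w) U₀, fun U hU => ?_⟩
    obtain ⟨hw, hU₀⟩ := Finset.insert_subset_iff.1 hU
    have hs : of Λ S w s = U.noncommProd (fun j => incl Λ S j (proj Λ S j (of Λ S w s)))
        (pairwise_commute Λ S U _) := by
      refine Eq.trans ?_ (Finset.mul_noncommProd_erase U hw _ (pairwise_commute Λ S U _))
      refine Eq.trans ?_ (congrArg _ ((Finset.noncommProd_eq_pow_card _ _ _ 1 ?_).trans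
        (one_pow _)).symm)
      · rw [mul_one, proj_of Λ S SimpleGraph.ConnectedComponent.connectedComponentMk_mem, incl_of]
      · intro j hj
        rw [proj_of_notMem Λ S, map_one]
        exact fun h => (Finset.mem_erase.1 hj).1 (Eq.symm h)
    conv_lhs => rw [ih U hU₀, hs]
    rw [← Finset.noncommProd_mul_distrib _ _ _ _ fun _ _ _ _ h => commute_incl Λ S h _ _]
    exact Finset.noncommProd_congr rfl (fun j _ => by simp) _

theorem isDirectSum_proj : IsDirectSum (proj Λ S) where
  ext p q h := by
    classical
    obtain ⟨U, hU⟩ := exists_eq_noncommProd Λ S p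
    obtain ⟨V, hV⟩ := exists_eq_noncommProd Λ S q
    rw [hU (U ∪ V) Finset.subset_union_left, hV (U ∪ V) Finset.subset_union_right]
    exact Finset.noncommProd_congr rfl (fun j _ => by rw [h]) _
  finite p := by
    induction p using induction_left with
    | one => simp
    | mul w s p ih =>
      refine (ih.insert (Λᶜ.connectedComponentMk w)).subset fun j hj => ?_
      by_contra h
      simp only [Set.mem_insert_iff, Set.mem_ofPred_eq, not_or, not_not] at h
      refine hj ?_
      rw [map_mul, h.2, mul_one, proj_of_notMem Λ S]
      exact fun hw => h.1 (Eq.symm hw)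
  surj f hf := by
    classical
    suffices ∀ (U : Finset (CoComponent Λ)) (f : ∀ j, ComponentProduct Λ S j),
        (∀ j ∉ U, f j = 1) → ∃ x, ∀ j, proj Λ S j x = f j from
      this hf.toFinset f (by simp)
    intro U
    induction U using Finset.induction_on with
    | empty => exact fun f h => ⟨1, fun j => by rw [map_one, h j (Finset.notMem_empty j)]⟩
    | insert a U ha ih =>
      intro f h
      obtain ⟨x, hx⟩ := ih (Function.update f a 1) (fun j hj => by
        by_cases hja : j = a
        · subst hja
          simp
        · rw [Function.update_of_ne hja, h j (by simp [hja, hj])])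
      refine ⟨incl Λ S a (f a) * x, fun j => ?_⟩
      by_cases hja : j = a
      · subst hja
        rw [map_mul, hx, proj_incl, Function.update_self, mul_one]
      · rw [map_mul, hx, proj_incl_of_ne Λ S hja, Function.update_of_ne hja, one_mul]

/-- The canonical isomorphism of the graph product with the direct sum of the graph products over
the coconnected components. -/
noncomputable def decomposition : GraphProduct Λ S ≃* directSum (ComponentProduct Λ S) :=
  MulEquiv.ofBijective
    ((MonoidHom.pi (proj Λ S)).codRestrict (directSum (ComponentProduct Λ S))
      (isDirectSum_proj Λ S).finite)
    ⟨fun x y h => (isDirectSum_proj Λ S).ext x y fun j => congrFun (congrArg Subtype.val h) j,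
      fun f => ((isDirectSum_proj Λ S).surj f f.2).imp fun _ h => Subtype.ext (funext h)⟩

theorem isCanonicalDecomposition : IsCanonicalDecomposition Λ S (decomposition Λ S) := by
  intro j w s
  refine ⟨proj_of Λ S w.2 s, fun j' hj' => proj_of_notMem Λ S (fun h => hj' ?_) s⟩
  exact h.symm.trans w.2

end GraphProduct

end Decomposition

/-! ### Direct sums of right LCM monoids -/

section Factor

variable {S : Type*} [Monoid S] [IsRightLCM S]

theorem IsLcm.coreEquiv_of_mem_core {s b x y : S} (h : IsLcm s b x y) (hb : b ∈ core S) :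
    x ∈ core S ∧ CoreEquiv (b * y) s := by
  have hx := h.symm.mem_core hb
  exact ⟨hx, h.1 ▸ coreEquiv_mul_core s hx⟩

/-- A least common multiple of a noncore irreducible and a core element, with the effect on
components. -/
theorem IsLcm.inComp (hA : ActionPreservesComponents S) {i : CoComponent (coreGraph S)}
    {s b x y : S} (h : IsLcm s b x y) (hb : b ∈ core S) (hs : InComp i s) :
    x ∈ core S ∧ InComp i y := by
  obtain ⟨hx, hy⟩ := h.coreEquiv_of_mem_core hb
  exact ⟨hx, (inComp_core_mul_iff hA hb).1 (hs.of_coreEquiv hy.symm)⟩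

/-- `t` is in the core if `s` is, and it is a noncore irreducible in the coconnected component of
`s` if `s` is a noncore irreducible.  Nothing is required of `t` if `s` is neither. -/
def SameType (s t : S) : Prop :=
  (s ∈ core S → t ∈ core S) ∧ ∀ i : CoComponent (coreGraph S), InComp i s → InComp i t

theorem SameType.refl (s : S) : SameType s s := ⟨id, fun _ => id⟩

theorem sameType_of_mem_core {s t : S} (hs : s ∈ core S) (ht : t ∈ core S) : SameType s t :=
  ⟨fun _ => ht, fun _ h => absurd hs h.irred.1⟩

theorem InComp.sameType {s t : S} {i : CoComponent (coreGraph S)} (hs : InComp i s)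
    (ht : InComp i t) : SameType s t :=
  ⟨fun h => absurd h hs.irred.1, fun _ h => h.unique hs ▸ ht⟩

/-- In one coordinate of a direct sum, least common multiples of core elements and noncore
irreducibles of different components preserve types. -/
theorem exists_isLcm_sameType (hB : BalancedFactorization S) {s t : S}
    (hs : s ∈ core S ∨ s ∈ noncoreIrred S) (ht : t ∈ core S ∨ t ∈ noncoreIrred S)
    (hst : ∀ i : CoComponent (coreGraph S), InComp i s → ¬ InComp i t) :
    ∃ x y, IsLcm s t x y ∧ SameType t x ∧ SameType s y := by
  have hA := hB.actionPreservesComponents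
  obtain hs | hs := hs <;> obtain ht | ht := ht
  · obtain ⟨x, y, hy, h⟩ := exists_core_isLcm hs t
    exact ⟨x, y, h, sameType_of_mem_core ht (h.symm.mem_core ht), sameType_of_mem_core hs hy⟩
  · obtain ⟨i, ht⟩ := exists_inComp ht
    obtain ⟨x, y, -, h⟩ := exists_core_isLcm hs t
    obtain ⟨h₁, h₂⟩ := h.symm.inComp hA hs ht
    exact ⟨x, y, h, ht.sameType h₂, sameType_of_mem_core hs h₁⟩
  · obtain ⟨i, hs⟩ := exists_inComp hs
    obtain ⟨x, y, -, h⟩ := exists_core_isLcm ht s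
    obtain ⟨h₁, h₂⟩ := h.symm.inComp hA ht hs
    exact ⟨y, x, h.symm, sameType_of_mem_core ht h₁, hs.sameType h₂⟩
  · obtain ⟨i, hs⟩ := exists_inComp hs
    obtain ⟨j, ht⟩ := exists_inComp ht
    obtain ⟨x, y, hx, hy, h⟩ := balancedFactorization_iff.1 hB i j s t
      (by rintro rfl; exact hst i hs ht) hs ht
    exact ⟨x, y, h, ht.sameType hx, hs.sameType hy⟩

/-- Core elements can be absorbed into products of noncore irreducibles. -/
theorem prod_mem_core_or_exists (l : List S) (hl : ∀ x ∈ l, x ∈ core S ∨ x ∈ noncoreIrred S) :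
    l.prod ∈ core S ∨ ∃ l' : List S, (∀ x ∈ l', x ∈ noncoreIrred S) ∧ CoreEquiv l.prod l'.prod := by
  induction l with
  | nil => exact .inl (one_mem _)
  | cons x l ih =>
    rw [List.prod_cons]
    obtain hc | ⟨l', hl', h⟩ := ih fun y hy => hl y (by simp [hy])
    · obtain hx | hx := hl x (by simp)
      · exact .inl (mul_mem hx hc)
      · exact .inr ⟨[x], by simpa using hx, by simpa using coreEquiv_mul_core x hc⟩
    · right
      have h' := (coreEquiv_mul_left_iff (a := x)).2 h
      obtain hx | hx := hl x (by simp)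
      · cases l' with
        | nil =>
          exact ⟨[], by simp, h'.trans (coreEquiv_of_mem_core (by simpa using hx) (one_mem _))⟩
        | cons y l' =>
          refine ⟨(x * y) :: l', fun z hz => ?_, by simpa [mul_assoc] using h'⟩
          obtain rfl | hz := List.mem_cons.1 hz
          · exact (core_mul_mem_noncoreIrred_iff hx).2 (hl' y (by simp))
          · exact hl' z (by simp [hz])
      · exact ⟨x :: l', by simpa using ⟨hx, hl'⟩, by simpa using h'⟩

end Factor

namespace IsDirectSum

variable {J T : Type*} {M : J → Type*} [Monoid T] [∀ j, Monoid (M j)] {π : ∀ j, T →* M j}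

theorem exists_single (hπ : IsDirectSum π) (j : J) (a : M j) :
    ∃ x, π j x = a ∧ ∀ k, k ≠ j → π k x = 1 := by
  classical
  obtain ⟨x, hx⟩ := hπ.surj (Function.update (1 : ∀ k, M k) j a)
    ((Set.finite_singleton j).subset fun k hk => by
      by_contra h
      exact hk (by rw [Function.update_of_ne h, Pi.one_apply]))
  exact ⟨x, by simp [hx], fun k hk => by simp [hx, Function.update_of_ne hk]⟩

/-- The inclusion of a summand. -/
noncomputable def single (hπ : IsDirectSum π) (j : J) : M j →* T where
  toFun a := (hπ.exists_single j a).choose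
  map_one' := hπ.ext _ _ fun k => by
    obtain ⟨h₁, h₂⟩ := (hπ.exists_single j 1).choose_spec
    by_cases h : k = j
    · subst h
      rw [h₁, map_one]
    · rw [h₂ k h, map_one]
  map_mul' a b := hπ.ext _ _ fun k => by
    obtain ⟨h₁, h₂⟩ := (hπ.exists_single j (a * b)).choose_spec
    obtain ⟨h₃, h₄⟩ := (hπ.exists_single j a).choose_spec
    obtain ⟨h₅, h₆⟩ := (hπ.exists_single j b).choose_spec
    by_cases h : k = j
    · subst h
      rw [map_mul, h₁, h₃, h₅]
    · rw [map_mul, h₂ k h, h₄ k h, h₆ k h, mul_one]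

@[simp] theorem proj_single (hπ : IsDirectSum π) (j : J) (a : M j) : π j (hπ.single j a) = a :=
  (hπ.exists_single j a).choose_spec.1

theorem proj_single_of_ne (hπ : IsDirectSum π) {j k : J} (h : k ≠ j) (a : M j) :
    π k (hπ.single j a) = 1 :=
  (hπ.exists_single j a).choose_spec.2 k h

/-- Solutions of a problem in each summand can be assembled if `1, 1` is a solution in all but
finitely many summands. -/
theorem exists_of_forall (hπ : IsDirectSum π) {F : Set J} (hF : F.Finite)
    (P : ∀ j, M j → M j → Prop) (h : ∀ j, ∃ a b, P j a b) (h₁ : ∀ j ∉ F, P j 1 1) :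
    ∃ x y, ∀ j, P j (π j x) (π j y) := by
  classical
  choose a b hab using h
  have key : ∀ a : ∀ j, M j, ∃ x, ∀ j, π j x = if j ∈ F then a j else 1 := fun a =>
    hπ.surj _ (hF.subset fun j hj => by
      by_contra h
      exact hj (if_neg h))
  obtain ⟨x, hx⟩ := key a
  obtain ⟨y, hy⟩ := key b
  refine ⟨x, y, fun j => ?_⟩
  rw [hx, hy]
  by_cases hj : j ∈ F
  · simpa only [if_pos hj] using hab j
  · simpa only [if_neg hj] using h₁ j hj

theorem finite_support₂ (hπ : IsDirectSum π) (x y : T) :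
    {j | π j x ≠ 1 ∨ π j y ≠ 1}.Finite :=
  (hπ.finite x).union (hπ.finite y)

theorem meets_iff (hπ : IsDirectSum π) {x y : T} : Meets x y ↔ ∀ j, Meets (π j x) (π j y) := by
  constructor
  · intro h j
    obtain ⟨u, v, h⟩ := GenScale.meets_iff.1 h
    exact Meets.of_eq (x := π j u) (y := π j v) (by rw [← map_mul, h, map_mul])
  · intro h
    obtain ⟨u, v, huv⟩ := hπ.exists_of_forall (hπ.finite_support₂ x y)
      (fun j a b => π j x * a = π j y * b) (fun j => GenScale.meets_iff.1 (h j))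
      (fun j hj => by
        simp only [Set.mem_ofPred_eq, not_or, not_not] at hj
        rw [hj.1, hj.2])
    exact Meets.of_eq (x := u) (y := v) (hπ.ext _ _ fun j => by rw [map_mul, map_mul, huv])

theorem mem_core_iff (hπ : IsDirectSum π) {x : T} : x ∈ core T ↔ ∀ j, π j x ∈ core (M j) := by
  constructor
  · intro h j s
    simpa using hπ.meets_iff.1 (h (hπ.single j s)) j
  · exact fun h y => hπ.meets_iff.2 fun j => h j (π j y)

theorem coreEquiv_iff (hπ : IsDirectSum π) {x y : T} :
    CoreEquiv x y ↔ ∀ j, CoreEquiv (π j x) (π j y) := by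
  constructor
  · rintro ⟨a, ha, b, hb, h⟩ j
    exact ⟨π j a, hπ.mem_core_iff.1 ha j, π j b, hπ.mem_core_iff.1 hb j,
      by rw [← map_mul, h, map_mul]⟩
  · intro h
    obtain ⟨u, v, huv⟩ := hπ.exists_of_forall (hπ.finite_support₂ x y)
      (fun j a b => a ∈ core (M j) ∧ b ∈ core (M j) ∧ π j x * a = π j y * b)
      (fun j => by
        obtain ⟨a, ha, b, hb, e⟩ := h j
        exact ⟨a, b, ha, hb, e⟩)
      (fun j hj => by
        simp only [Set.mem_ofPred_eq, not_or, not_not] at hj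
        exact ⟨one_mem _, one_mem _, by rw [hj.1, hj.2]⟩)
    exact ⟨u, hπ.mem_core_iff.2 fun j => (huv j).1, v, hπ.mem_core_iff.2 fun j => (huv j).2.1,
      hπ.ext _ _ fun j => by rw [map_mul, map_mul, (huv j).2.2]⟩

theorem isLcm_iff (hπ : IsDirectSum π) {x y u v : T} :
    IsLcm x y u v ↔ ∀ j, IsLcm (π j x) (π j y) (π j u) (π j v) := by
  constructor
  · rintro ⟨h₁, h₂⟩ j
    refine ⟨by rw [← map_mul, h₁, map_mul], fun a b hab => ?_⟩
    -- In the other coordinates the common multiple given by `u` and `v` is used.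
    obtain ⟨p, q, hpq⟩ := hπ.exists_of_forall ((hπ.finite_support₂ u v).insert j)
      (fun k c d => π k x * c = π k y * d ∧ ∀ h : k = j, c = h ▸ a ∧ d = h ▸ b)
      (fun k => by
        by_cases h : k = j
        · subst h
          exact ⟨a, b, hab, fun _ => ⟨rfl, rfl⟩⟩
        · exact ⟨π k u, π k v, by rw [← map_mul, h₁, map_mul], fun h' => absurd h' h⟩)
      (fun k hk => by
        simp only [Set.mem_insert_iff, Set.mem_ofPred_eq, not_or, not_not] at hk
        have := congrArg (π k) h₁
        rw [map_mul, map_mul, hk.2.1, hk.2.2] at this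
        exact ⟨this, fun h => absurd h hk.1⟩)
    obtain ⟨w, rfl, rfl⟩ := h₂ p q (hπ.ext _ _ fun k => by rw [map_mul, map_mul, (hpq k).1])
    obtain ⟨h₃, h₄⟩ := (hpq j).2 rfl
    exact ⟨π j w, by rw [← map_mul]; exact h₃.symm, by rw [← map_mul]; exact h₄.symm⟩
  · intro h
    refine ⟨hπ.ext _ _ fun j => by rw [map_mul, map_mul, (h j).1], fun p q hpq => ?_⟩
    obtain ⟨w, -, hw⟩ := hπ.exists_of_forall
      ((hπ.finite_support₂ p q).union (hπ.finite_support₂ u v))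
      (fun j c _ => π j p = π j u * c ∧ π j q = π j v * c)
      (fun j => by
        obtain ⟨w, hw⟩ := (h j).2 (π j p) (π j q) (by rw [← map_mul, hpq, map_mul])
        exact ⟨w, 1, hw⟩)
      (fun j hj => by
        simp only [Set.mem_union, Set.mem_ofPred_eq, not_or, not_not] at hj
        rw [hj.1.1, hj.1.2, hj.2.1, hj.2.2]
        simp)
    exact ⟨w, hπ.ext _ _ fun j => by rw [map_mul, (hw j).1],
      hπ.ext _ _ fun j => by rw [map_mul, (hw j).2]⟩

theorem coreEquiv_single_iff (hπ : IsDirectSum π) {j : J} {a b : M j} :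
    CoreEquiv (hπ.single j a) (hπ.single j b) ↔ CoreEquiv a b := by
  refine ⟨fun h => by simpa using hπ.coreEquiv_iff.1 h j, fun h => hπ.coreEquiv_iff.2 fun k => ?_⟩
  by_cases hk : k = j
  · subst hk
    simpa using h
  · rw [hπ.proj_single_of_ne hk, hπ.proj_single_of_ne hk]
    exact .refl _

variable [∀ j, IsRightLCM (M j)]

theorem coreEquiv_single (hπ : IsDirectSum π) {x : T} {j : J}
    (hx : ∀ k, k ≠ j → π k x ∈ core (M k)) :
    CoreEquiv x (hπ.single j (π j x)) := by
  refine hπ.coreEquiv_iff.2 fun k => ?_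
  by_cases h : k = j
  · subst h
    rw [proj_single]
    exact .refl _
  · rw [hπ.proj_single_of_ne h]
    exact coreEquiv_of_mem_core (hx k h) (one_mem _)

/-- The noncore irreducibles of a direct sum have exactly one noncore coordinate, which is noncore
irreducible. -/
theorem mem_noncoreIrred_iff (hπ : IsDirectSum π) {x : T} : x ∈ noncoreIrred T ↔
    ∃ j, π j x ∈ noncoreIrred (M j) ∧ ∀ k, k ≠ j → π k x ∈ core (M k) := by
  classical
  constructor
  · rintro ⟨h₁, h₂⟩
    have : ∃ j, π j x ∉ core (M j) := by
      by_contra h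
      push Not at h
      exact h₁ (hπ.mem_core_iff.2 h)
    obtain ⟨j, hj⟩ := this
    -- `r c` has coordinate `c` at `j` and agrees with `x` elsewhere.
    have hr : ∀ c : M j, ∃ r, π j r = c ∧ ∀ k, k ≠ j → π k r = π k x := by
      intro c
      obtain ⟨r, hr⟩ := hπ.surj (Function.update (fun k => π k x) j c)
        (((hπ.finite x).insert j).subset fun k hk => by
          by_contra h
          simp only [Set.mem_insert_iff, Set.mem_ofPred_eq, not_or, not_not] at h
          exact hk (by rw [Function.update_of_ne h.1, h.2]))
      exact ⟨r, by simp [hr], fun k hk => by rw [hr, Function.update_of_ne hk]⟩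
    refine ⟨j, ⟨hj, fun a ha t c htc => ?_⟩, fun k hk => ?_⟩
    · obtain ⟨r, hr₁, hr₂⟩ := hr c
      have := h₂ (hπ.single j a) (hπ.mem_core_iff.2 fun k => ?_) (hπ.single j t) r
        (hπ.ext _ _ fun k => ?_)
      · refine this.imp (fun h => ?_) (fun h => ?_)
        · simpa using hπ.mem_core_iff.1 h j
        · exact hr₁ ▸ hπ.mem_core_iff.1 h j
      · by_cases hk : k = j
        · subst hk
          simpa using ha
        · rw [hπ.proj_single_of_ne hk]
          exact one_mem _
      · by_cases hk : k = j
        · subst hk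
          simp [hr₁, htc]
        · rw [map_mul, map_mul, hπ.proj_single_of_ne hk, hπ.proj_single_of_ne hk, hr₂ k hk, one_mul,
            mul_one]
    · obtain ⟨r, hr₁, hr₂⟩ := hr 1
      have := h₂ 1 (one_mem _) (hπ.single j (π j x)) r (hπ.ext _ _ fun k => by
        by_cases hk : k = j
        · subst hk
          simp [hr₁]
        · rw [mul_one, map_mul, hπ.proj_single_of_ne hk, hr₂ k hk, one_mul])
      obtain h | h := this
      · exact absurd (by simpa using hπ.mem_core_iff.1 h j) hj
      · exact hr₂ k hk ▸ hπ.mem_core_iff.1 h k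
  · rintro ⟨j, hj, hx⟩
    refine ⟨fun h => hj.1 (hπ.mem_core_iff.1 h j), fun a ha t r h => ?_⟩
    have hk : ∀ k, k ≠ j → π k t ∈ core (M k) ∧ π k r ∈ core (M k) := fun k hk => by
      rw [← mul_mem_core_iff, ← map_mul, ← h, map_mul]
      exact mul_mem (hx k hk) (hπ.mem_core_iff.1 ha k)
    have := hj.2 (π j a) (hπ.mem_core_iff.1 ha j) (π j t) (π j r) (by rw [← map_mul, h, map_mul])
    refine this.imp (fun h => hπ.mem_core_iff.2 fun k => ?_) fun h => hπ.mem_core_iff.2 fun k => ?_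
    all_goals
      by_cases hkj : k = j
      · subst hkj
        exact h
    exacts [(hk k hkj).1, (hk k hkj).2]

theorem single_mem_noncoreIrred (hπ : IsDirectSum π) {j : J} {s : M j}
    (hs : s ∈ noncoreIrred (M j)) : hπ.single j s ∈ noncoreIrred T :=
  hπ.mem_noncoreIrred_iff.2 ⟨j, by simpa using hs, fun k hk => by
    rw [hπ.proj_single_of_ne hk]
    exact one_mem _⟩

variable [IsRightLCM T]

/-- The coconnected component of the core graph of the direct sum that is given by a coconnected
component of the core graph of a summand. -/
noncomputable def comp (hπ : IsDirectSum π) (p : Σ j, CoComponent (coreGraph (M j))) :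
    CoComponent (coreGraph T) :=
  (exists_inComp (hπ.single_mem_noncoreIrred (coIndex_surjective p.2).choose_spec.irred)).choose

theorem inComp_comp_iff (hπ : IsDirectSum π) {j : J} {i : CoComponent (coreGraph (M j))} {x : T} :
    InComp (hπ.comp ⟨j, i⟩) x ↔ InComp i (π j x) ∧ ∀ k, k ≠ j → π k x ∈ core (M k) := by
  obtain ⟨s, hs, hc⟩ : ∃ s, InComp i s ∧ InComp (hπ.comp ⟨j, i⟩) (hπ.single j s) :=
    ⟨_, (coIndex_surjective i).choose_spec, (exists_inComp
      (hπ.single_mem_noncoreIrred (coIndex_surjective i).choose_spec.irred)).choose_spec⟩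
  constructor
  · intro hx
    refine hc.induction (p := fun x => InComp i (π j x) ∧ ∀ k, k ≠ j → π k x ∈ core (M k)) hx
      ⟨by simpa using hs, fun k hk => by rw [hπ.proj_single_of_ne hk]; exact one_mem _⟩ ?_
    rintro u v - hv ⟨h₁, h₂⟩ (h | h)
    · have h := hπ.coreEquiv_iff.1 h
      exact ⟨h₁.of_coreEquiv (h j), fun k hk => (h k).mem_core (h₂ k hk)⟩
    · obtain ⟨k, hk, hk'⟩ := hπ.mem_noncoreIrred_iff.1 hv
      rw [hπ.meets_iff] at h
      push Not at h
      obtain ⟨l, hl⟩ := h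
      have hlj : l = j := by
        by_contra hne
        exact hl (h₂ l hne _)
      have hlk : l = k := by
        by_contra hne
        exact hl (hk' l hne _).symm
      subst hlj hlk
      exact ⟨h₁.of_not_meets hk hl, hk'⟩
  · rintro ⟨h₁, h₂⟩
    refine InComp.of_coreEquiv ?_ (hπ.coreEquiv_single h₂).symm
    refine hs.induction (p := fun s => InComp (hπ.comp ⟨j, i⟩) (hπ.single j s)) h₁ hc ?_
    rintro u v - hv hu (h | h)
    · exact hu.of_coreEquiv (hπ.coreEquiv_single_iff.2 h)
    · exact hu.of_not_meets (hπ.single_mem_noncoreIrred hv) fun h' =>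
        h (by simpa using hπ.meets_iff.1 h' j)

theorem inComp_comp_single (hπ : IsDirectSum π) {j : J} {i : CoComponent (coreGraph (M j))}
    {s : M j} (hs : InComp i s) : InComp (hπ.comp ⟨j, i⟩) (hπ.single j s) :=
  hπ.inComp_comp_iff.2 ⟨by simpa using hs, fun k hk => by
    rw [hπ.proj_single_of_ne hk]
    exact one_mem _⟩

theorem comp_bijective (hπ : IsDirectSum π) : Function.Bijective hπ.comp := by
  constructor
  · rintro ⟨j, i⟩ ⟨j', i'⟩ h
    obtain ⟨s, hs⟩ := coIndex_surjective i
    have hx := hπ.inComp_comp_single hs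
    rw [h, inComp_comp_iff] at hx
    by_cases hj : j' = j
    · subst hj
      rw [proj_single] at hx
      rw [hs.unique hx.1]
    · rw [hπ.proj_single_of_ne hj] at hx
      exact absurd (one_mem _) hx.1.irred.1
  · intro c
    obtain ⟨x, hx⟩ := coIndex_surjective c
    obtain ⟨j, hj, hk⟩ := hπ.mem_noncoreIrred_iff.1 hx.irred
    obtain ⟨i, hi⟩ := exists_inComp hj
    exact ⟨⟨j, i⟩, (hπ.inComp_comp_iff.2 ⟨hi, hk⟩).unique hx⟩

theorem componentSize_comp (hπ : IsDirectSum π) (p : Σ j, CoComponent (coreGraph (M j))) :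
    componentSize (hπ.comp p) = componentSize p.2 := by
  obtain ⟨j, i⟩ := p
  let f : CoreQuotient (M j) → CoreQuotient T :=
    Quotient.map (hπ.single j) (fun _ _ h => hπ.coreEquiv_single_iff.2 h)
  have hf : ∀ s, f (coreClass s) = coreClass (hπ.single j s) := fun _ => rfl
  have hinj : Function.Injective f := by
    intro x y h
    obtain ⟨s, rfl⟩ := coreClass_surjective x
    obtain ⟨t, rfl⟩ := coreClass_surjective y
    exact coreClass_eq_iff.2 (hπ.coreEquiv_single_iff.1 (coreClass_eq_iff.1 h))
  rw [componentSize, componentSize, ← hinj.encard_image]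
  congr 1
  ext x
  constructor
  · intro hx
    obtain ⟨y, rfl⟩ := coreClass_surjective x
    obtain ⟨h₁, h₂⟩ := hπ.inComp_comp_iff.1 (coreClass_mem_componentVertices.1 hx)
    exact ⟨_, coreClass_mem_componentVertices.2 h₁,
      coreClass_eq_iff.2 (hπ.coreEquiv_single h₂).symm⟩
  · rintro ⟨y, hy, rfl⟩
    obtain ⟨s, rfl⟩ := coreClass_surjective y
    exact coreClass_mem_componentVertices.2
      (hπ.inComp_comp_single (coreClass_mem_componentVertices.1 hy))

theorem componentsEdgeFree_iff (hπ : IsDirectSum π) :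
    ComponentsEdgeFree T ↔ ∀ j, ComponentsEdgeFree (M j) := by
  simp only [GenScale.componentsEdgeFree_iff]
  constructor
  · intro h j i s t hs ht hm
    refine hπ.coreEquiv_single_iff.1 (h _ _ _ (hπ.inComp_comp_single hs)
      (hπ.inComp_comp_single ht) (hπ.meets_iff.2 fun k => ?_))
    by_cases hk : k = j
    · subst hk
      simpa using hm
    · rw [hπ.proj_single_of_ne hk, hπ.proj_single_of_ne hk]
      exact meets_one_left 1
  · intro h c x y hx hy hm
    obtain ⟨⟨j, i⟩, rfl⟩ := hπ.comp_bijective.2 c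
    obtain ⟨hx₁, hx₂⟩ := hπ.inComp_comp_iff.1 hx
    obtain ⟨hy₁, hy₂⟩ := hπ.inComp_comp_iff.1 hy
    refine hπ.coreEquiv_iff.2 fun k => ?_
    by_cases hk : k = j
    · subst hk
      exact h k i _ _ hx₁ hy₁ (hπ.meets_iff.1 hm k)
    · exact coreEquiv_of_mem_core (hx₂ k hk) (hy₂ k hk)

theorem noncoreFactorable_iff (hπ : IsDirectSum π) :
    NoncoreFactorable T ↔ ∀ j, NoncoreFactorable (M j) := by
  constructor
  · intro h j s hs
    obtain ⟨l, hl, hsl⟩ := h (hπ.single j s) fun h => hs (by simpa using hπ.mem_core_iff.1 h j)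
    have hsl := hπ.coreEquiv_iff.1 hsl j
    rw [proj_single, map_list_prod] at hsl
    obtain hc | ⟨l', hl', h'⟩ := prod_mem_core_or_exists (l.map (π j)) (fun x hx => by
      obtain ⟨y, hy, rfl⟩ := List.mem_map.1 hx
      obtain ⟨k, hk, hk'⟩ := hπ.mem_noncoreIrred_iff.1 (hl y hy)
      by_cases hjk : j = k
      · subst hjk
        exact .inr hk
      · exact .inl (hk' j hjk))
    · exact absurd (hsl.symm.mem_core hc) hs
    · exact ⟨l', hl', hsl.trans h'⟩
  · intro h x hx
    suffices key : ∀ (U : Finset J) (x : T), (∀ j ∉ U, π j x ∈ core (M j)) → x ∈ core T ∨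
        ∃ l : List T, (∀ y ∈ l, y ∈ noncoreIrred T) ∧ CoreEquiv x l.prod from
      (key (hπ.finite x).toFinset x (fun j hj => by
        simp only [Set.Finite.mem_toFinset, Set.mem_ofPred_eq, not_not] at hj
        rw [hj]
        exact one_mem _)).resolve_left hx
    clear hx x
    classical
    intro U
    induction U using Finset.induction_on with
    | empty => exact fun x hx => .inl (hπ.mem_core_iff.2 fun j => hx j (Finset.notMem_empty j))
    | insert a U ha ih =>
      intro x hx
      by_cases hxa : π a x ∈ core (M a)
      · refine ih x fun j hj => ?_
        by_cases hja : j = a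
        · exact hja ▸ hxa
        · exact hx j (by simp [hja, hj])
      right
      -- `x'` is `x` with the coordinate at `a` replaced by `1`.
      obtain ⟨x', hx'⟩ := hπ.surj (Function.update (fun k => π k x) a 1)
        ((hπ.finite x).subset fun k hk => by
          by_contra h'
          by_cases hka : k = a
          · subst hka
            simp at hk
          · exact hk (by simpa [Function.update_of_ne hka] using h'))
      have hx'a : π a x' = 1 := by simp [hx']
      have hx'k : ∀ k, k ≠ a → π k x' = π k x := fun k hk => by
        rw [hx', Function.update_of_ne hk]
      obtain ⟨l, hl, hla⟩ := h a _ hxa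
      have hxl : CoreEquiv x (hπ.single a l.prod * x') := by
        refine hπ.coreEquiv_iff.2 fun k => ?_
        by_cases hka : k = a
        · subst hka
          simpa [hx'a] using hla
        · rw [map_mul, hπ.proj_single_of_ne hka, one_mul, hx'k k hka]
          exact .refl _
      have hl₁ : ∀ y ∈ l.map (hπ.single a), y ∈ noncoreIrred T := fun y hy => by
        obtain ⟨s, hs, rfl⟩ := List.mem_map.1 hy
        exact hπ.single_mem_noncoreIrred (hl s hs)
      obtain hc | ⟨l', hl', hl'x⟩ := ih x' (fun j hj => by
        by_cases hja : j = a
        · subst hja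
          rw [hx'a]
          exact one_mem _
        · rw [hx'k j hja]
          exact hx j (by simp [hja, hj]))
      · exact ⟨_, hl₁, by
          rw [← map_list_prod]
          exact hxl.trans (coreEquiv_mul_core _ hc)⟩
      · refine ⟨l.map (hπ.single a) ++ l', fun y hy => ?_, ?_⟩
        · exact (List.mem_append.1 hy).elim (hl₁ y) (hl' y)
        · rw [List.prod_append, ← map_list_prod]
          exact hxl.trans (coreEquiv_mul_left_iff.2 hl'x)

theorem balancedFactorization_iff (hπ : IsDirectSum π) : BalancedFactorization T ↔
    ∀ j, BalancedFactorization (M j) := by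
  constructor
  · intro h j
    rw [GenScale.balancedFactorization_iff] at h ⊢
    intro i i' s t hii hs ht
    obtain ⟨t', s', ht', hs', hl⟩ := h _ _ _ _
      (fun e => hii (by simpa using hπ.comp_bijective.1 e))
      (hπ.inComp_comp_single hs) (hπ.inComp_comp_single ht)
    refine ⟨π j t', π j s', (hπ.inComp_comp_iff.1 ht').1, (hπ.inComp_comp_iff.1 hs').1, ?_⟩
    simpa using hπ.isLcm_iff.1 hl j
  · intro h
    rw [GenScale.balancedFactorization_iff]
    intro c c' x y hcc hx hy
    obtain ⟨⟨j, i⟩, rfl⟩ := hπ.comp_bijective.2 c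
    obtain ⟨⟨j', i'⟩, rfl⟩ := hπ.comp_bijective.2 c'
    obtain ⟨hx₁, hx₂⟩ := hπ.inComp_comp_iff.1 hx
    obtain ⟨hy₁, hy₂⟩ := hπ.inComp_comp_iff.1 hy
    obtain ⟨u, v, huv⟩ := hπ.exists_of_forall (hπ.finite_support₂ x y)
      (fun k p q => IsLcm (π k x) (π k y) p q ∧ SameType (π k y) p ∧ SameType (π k x) q)
      (fun k => by
        refine exists_isLcm_sameType (h k) ?_ ?_ fun c hc hc' => ?_
        · by_cases hk : k = j
          · subst hk
            exact .inr hx₁.irred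
          · exact .inl (hx₂ k hk)
        · by_cases hk : k = j'
          · subst hk
            exact .inr hy₁.irred
          · exact .inl (hy₂ k hk)
        · by_cases hk : k = j
          · subst hk
            by_cases hk' : k = j'
            · subst hk'
              exact hcc (by rw [hx₁.unique hc, hy₁.unique hc'])
            · exact hc'.irred.1 (hy₂ k hk')
          · exact hc.irred.1 (hx₂ k hk))
      (fun k hk => by
        simp only [Set.mem_ofPred_eq, not_or, not_not] at hk
        rw [hk.1, hk.2]
        exact ⟨⟨rfl, fun a b e => ⟨a, by simp, by simpa using e.symm⟩⟩, .refl 1, .refl 1⟩)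
    refine ⟨u, v, hπ.inComp_comp_iff.2 ⟨(huv j').2.1.2 i' hy₁, fun k hk => ?_⟩,
      hπ.inComp_comp_iff.2 ⟨(huv j).2.2.2 i hx₁, fun k hk => ?_⟩,
      hπ.isLcm_iff.2 fun k => (huv k).1⟩
    · exact (huv k).2.1.1 (hy₂ k hk)
    · exact (huv k).2.2.1 (hx₂ k hk)

end IsDirectSum

theorem FreelyGeneratesNontrivial.comp_equiv {I I' : Type*} {c : I → ℕ∞}
    (h : FreelyGeneratesNontrivial c) (e : I' ≃ I) : FreelyGeneratesNontrivial (c ∘ e) := by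
  obtain ⟨m, hm, hinj, hbot⟩ := h
  rw [injective_finsuppProd_iff] at hinj
  refine ⟨m ∘ e, fun i => hm (e i), (injective_finsuppProd_iff _).2 fun D E h => ?_, ?_⟩
  · refine Multiset.map_injective e.injective (hinj ?_)
    simpa [Multiset.map_map] using h
  · rwa [e.surjective.range_comp]

end GenScale

theorem mainTheorem3 {W : Type*} (Λ : SimpleGraph W) (S : W → Type*) [∀ w, Monoid (S w)]
    [∀ w, IsRightLCM (S w)] :
    ∃ (_ : IsRightLCM (GraphProduct Λ S))
      (_ : ∀ j : CoComponent Λ, IsRightLCM (ComponentProduct Λ S j)),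
      (∃ e : GraphProduct Λ S ≃* directSum (ComponentProduct Λ S),
        IsCanonicalDecomposition Λ S e ∧
        e '' noncoreIrred (GraphProduct Λ S) = ⋃ j : CoComponent Λ, irredSummand Λ S j ∧
        Pairwise (fun j j' : CoComponent Λ =>
          Disjoint (irredSummand Λ S j) (irredSummand Λ S j'))) ∧
      (ComponentsEdgeFree (GraphProduct Λ S) ↔
        ∀ j : CoComponent Λ, ComponentsEdgeFree (ComponentProduct Λ S j)) ∧
      (NoncoreFactorable (GraphProduct Λ S) ↔
        ∀ j : CoComponent Λ, NoncoreFactorable (ComponentProduct Λ S j)) ∧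
      (BalancedFactorization (GraphProduct Λ S) ↔
        ∀ j : CoComponent Λ, BalancedFactorization (ComponentProduct Λ S j) ∧
          ActionPreservesComponents (ComponentProduct Λ S j)) ∧
      ((∃ N : GraphProduct Λ S →* ℕ+, IsGeneralizedScale N) ↔
        (∀ j : CoComponent Λ, ComponentsEdgeFree (ComponentProduct Λ S j) ∧
          NoncoreFactorable (ComponentProduct Λ S j) ∧
          BalancedFactorization (ComponentProduct Λ S j)) ∧
        FreelyGeneratesNontrivial
          (fun p : Σ j : CoComponent Λ, CoComponent (coreGraph (ComponentProduct Λ S j)) =>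
            componentSize p.2)) := by
  have hπ := GraphProduct.isDirectSum_proj Λ S
  refine ⟨inferInstance, fun j => inferInstance, ⟨GraphProduct.decomposition Λ S,
    GraphProduct.isCanonicalDecomposition Λ S, ?_, ?_⟩, hπ.componentsEdgeFree_iff,
    hπ.noncoreFactorable_iff, ?_, ?_⟩
  · ext f
    obtain ⟨x, rfl⟩ := (GraphProduct.decomposition Λ S).surjective f
    rw [(GraphProduct.decomposition Λ S).injective.mem_set_image, hπ.mem_noncoreIrred_iff,
      Set.mem_iUnion]
    rfl
  · refine fun j j' hj => Set.disjoint_left.2 fun x hx hx' => ?_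
    exact hx.1.1 (hx'.2 j hj)
  · rw [hπ.balancedFactorization_iff]
    exact forall_congr' fun j => ⟨fun h => ⟨h, h.actionPreservesComponents⟩, And.left⟩
  · rw [exists_isGeneralizedScale_iff, hπ.componentsEdgeFree_iff, hπ.noncoreFactorable_iff,
      hπ.balancedFactorization_iff]
    have hsize : (fun p : Σ j : CoComponent Λ, CoComponent (coreGraph (ComponentProduct Λ S j)) =>
        componentSize p.2) = componentSize ∘ Equiv.ofBijective hπ.comp hπ.comp_bijective :=
      funext fun p => (hπ.componentSize_comp p).symm
    have hfree : FreelyGeneratesNontrivial (componentSize (S := GraphProduct Λ S)) ↔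
        FreelyGeneratesNontrivial
          (fun p : Σ j : CoComponent Λ, CoComponent (coreGraph (ComponentProduct Λ S j)) =>
            componentSize p.2) := by
      rw [hsize]
      refine ⟨fun h => h.comp_equiv _, fun h => ?_⟩
      have := h.comp_equiv (Equiv.ofBijective hπ.comp hπ.comp_bijective).symm
      rwa [Function.comp_assoc, Equiv.self_comp_symm, Function.comp_id] at this
    rw [hfree]
    simp only [forall_and, and_assoc]
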